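/- **Setting.** Let $D\subseteq\mathbb{R}$ be a Borel set, $a\in D$, and let $k:D\times D\to\mathbb{R}$ be a measurable reproducing kernel (symmetric and positive semi-definite) with $k(a,a)=0$. Let $\rho$ be a probability measure on $D$ with $M:=\int_D k(x,x)\,\rho(dx)<\infty$ and $C_0:=\int_D\int_D k(x,y)\,\rho(dx)\rho(dy)>0$. Let $\mathcal{U}$ be the set of finite subsets of $\mathbb{N}=\{1,2,\dots\}$ and let $\gamma=(\gamma_u)_{u\in\mathcal{U}}$ be non-negative weights with $\sum_{u}\gamma_uM^{|u|}<\infty$ and $\gamma_{\{1\}}>0$. Put $k_u(\mathbf{x},\mathbf{y})=\prod_{j\in u}k(x_j,y_j)$ for $\mathbf{x},\mathbf{y}\in D^{\mathbb{N}}$, $\mathcal{X}=\{\mathbf{x}\in D^{\mathbb{N}}:\sum_u\gamma_uk_u(\mathbf{x},\mathbf{x})<\infty\}$, and let $\mathcal{H}_\gamma$ be the reproducing kernel Hilbert space on $\mathcal{X}$ with kernel $K_\gamma=\sum_u\gamma_uk_u$, $B_\gamma$ its norm unit ball. Functions in $\mathcal{H}_\gamma$ are extended by $0$ to $D^{\mathbb{N}}$.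 The integral to be approximated is $I(f)=\int_{\mathcal{X}}f\,d\mu$, where $\mu$ is the infinite product of $\rho$ on $D^{\mathbb{N}}$. **Algorithms and cost.** A randomized algorithm $Q$ consists of a probability space and, for each of its elements, a deterministic algorithm that evaluates the input $f$ at sequentially (adaptively) chosen points until it stops, and then computes a real output from the values seen. For every $f$ in the space under consideration it is required that $Q$ stops almost surely, that the output $Q(f)$ is a square-integrable random variable, and that the cost is a random variable. Here the cost is the sum of the costs of all evaluations that are performed. Let $\$:\mathbb{N}_0\to[1,\infty]$ be monotone increasing with $\$(\nu)=\Omega(\nu^s)$ for some $s>0$. For $v\in\mathcal{U}$ put $\mathcal{X}_{v,a}=\{\mathbf{x}\in D^{\mathbb{N}}:x_j=a\text{ for all }j\notin v\}$. In the unrestricted subspace sampling model an evaluation at $\mathbf{x}$ costs $c_a(\mathbf{x})=\inf\{\$(|v|):v\in\mathcal{U},\ \mathbf{x}\in\mathcal{X}_{v,a}\}$ (with $\inf\emptyset=\infty$). For $\omega\in\mathbb{N}$, the class $\mathcal{A}^{\mathrm{res}-\omega}$ consists of the randomized algorithms $Q$ on $\mathcal{H}_\gamma$ for which there are $n\in\mathbb{N}_0$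 and $v_1,\dots,v_n\in\mathcal{U}$ with $|v_i|\le\omega$ such that, for every $f\in\mathcal{H}_\gamma$, $Q$ almost surely performs exactly $n$ evaluations of $f$, the $i$-th sample point lies in $\mathcal{X}_{v_i,a}$, and the expected cost is $\sum_{i=1}^n\$(|v_i|)$. **Error and exponent.** For a class $F$ of integrands let $e(Q,F)=\big(\sup_{f\in F}\mathbb{E}(I(f)-Q(f))^2\big)^{1/2}$ be the randomized worst case error and $\mathrm{cost}(Q,F)=\sup_{f\in F}\mathbb{E}(\mathrm{cost}(Q,f))$ the worst case cost. Let $\mathrm{comp}(\varepsilon)$ be the infimum of $\mathrm{cost}(Q,B_\gamma)$, with respect to $c_a$, over all $Q\in\mathcal{A}^{\mathrm{res}-\omega}$ with $e(Q,B_\gamma)\le\varepsilon$. Let $p^{\mathrm{res}-\omega}_{\mathrm{unr}}\in[0,\infty]$ be the infimum of all $p\ge0$ for which there is $C>0$ with $\mathrm{comp}(\varepsilon)\le C\varepsilon^{-p}$ for all $\varepsilon>0$ ($\inf\emptyset=\infty$). **Univariate assumption.** Let $B(\gamma_{\{1\}}k)$ be the unit ball of the reproducing kernel Hilbert space on $D$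 with kernel $\gamma_{\{1\}}k$. Let $e^{\mathrm{ran}}(N,B(\gamma_{\{1\}}k))$ be the infimum of the randomized worst case errors on this ball for the functional $f\mapsto\int_Df\,d\rho$, over all randomized algorithms on that space with worst case cost at most $N$, where every evaluation costs $\$(1)$. Assume that $\alpha>0$ satisfies $e^{\mathrm{ran}}(N,B(\gamma_{\{1\}}k))=\Omega(N^{-\alpha/2})$ as $N\to\infty$. **Decay.** For $\sigma\in\mathbb{N}$ let $\gamma^{(\sigma)}_u=\gamma_u$ if $|u|\le\sigma$ and $\gamma^{(\sigma)}_u=0$ otherwise, and put $\widehat\gamma^{(\sigma)}_u=\gamma^{(\sigma)}_uC_0^{|u|}$. Let $u_1,u_2,\dots$ be the distinct non-empty sets with $\gamma^{(\sigma)}_u>0$, ordered such that $\widehat\gamma^{(\sigma)}_{u_1}\ge\widehat\gamma^{(\sigma)}_{u_2}\ge\cdots$. Put $\mathrm{decay}_{\gamma,\sigma}=\sup\{p\in\mathbb{R}:\lim_{j\to\infty}\widehat\gamma^{(\sigma)}_{u_j}j^p=0\}\in[1,\infty]$, which is $\infty$ if there are only finitely many such sets. **Theorem.** Let $\omega\in\mathbb{N}$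 be fixed. Then $$p^{\mathrm{res}-\omega}_{\mathrm{unr}}\ \ge\ \max\Big\{\frac2\alpha,\ \sup_{\sigma\in\mathbb{N}}\frac{2}{\mathrm{decay}_{\gamma,\sigma}-1}\Big\},$$ where $2/0=\infty$ and $2/\infty=0$. -/

import Mathlib

open MeasureTheory Filter Topology
open scoped ENNReal NNReal

universe u

noncomputable section

namespace InfInt

/-! ### Scalar reproducing kernel Hilbert spaces -/

section Kernels

variable {X : Type}

/-- A real kernel, viewed as a kernel with values in the operators on the Hilbert space `ℝ`
(the format used by Mathlib's theory of reproducing kernel Hilbert spaces). -/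
def opKernel (K : Matrix X X ℝ) : Matrix X X (ℝ →L[ℝ] ℝ) :=
  Matrix.of fun x y => K x y • ContinuousLinearMap.id ℝ ℝ

theorem opKernel_posSemidef {K : Matrix X X ℝ} (hK : K.PosSemidef) :
    (opKernel K).PosSemidef := by
  have key := (RKHS.posSemidef_tfae (𝕜 := ℝ) (K := opKernel K)).out 0 2
  refine key.mpr ⟨?_, fun v => ?_⟩
  · have h1 : star (ContinuousLinearMap.id ℝ ℝ) = ContinuousLinearMap.id ℝ ℝ :=
      star_one (ℝ →L[ℝ] ℝ)
    ext x y
    have := hK.1.apply x y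
    simp only [star_trivial] at this
    simp [opKernel, Matrix.conjTranspose_apply, this, star_smul, h1]
  · have h := hK.2 v
    rw [Finsupp.sum_comm]
    refine h.trans_eq ?_
    simp [opKernel, Finsupp.sum, mul_comm, mul_left_comm]

/-- The set of functions that make up the reproducing kernel Hilbert space `H(K)`. -/
def rkhs (K : Matrix X X ℝ) (hK : K.PosSemidef) : Set (X → ℝ) :=
  haveI : Fact (opKernel K).PosSemidef := ⟨opKernel_posSemidef hK⟩
  {f | ∃ g : RKHS.OfKernel (opKernel K), ∀ x, f x = g x}

/-- The norm unit ball `B(K)` of the reproducing kernel Hilbert space `H(K)`. -/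
def rkhsBall (K : Matrix X X ℝ) (hK : K.PosSemidef) : Set (X → ℝ) :=
  haveI : Fact (opKernel K).PosSemidef := ⟨opKernel_posSemidef hK⟩
  {f | ∃ g : RKHS.OfKernel (opKernel K), ‖g‖ ≤ 1 ∧ ∀ x, f x = g x}

end Kernels

/-! ### Algorithms, cost, error, complexity -/

/-- A deterministic (adaptive, nonlinear, sequentially stopping) algorithm that uses function
values: from the list of the values seen so far it decides whether to stop; if it does not stop,
it computes the next sample point from that list; when it stops, it computes its output. -/
structure DetAlgorithm (X : Type) where
  halt : List ℝ → Prop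
  point : List ℝ → X
  output : List ℝ → ℝ

namespace DetAlgorithm

variable {X : Type} (A : DetAlgorithm X) (f : X → ℝ)

/-- The first `i` function values seen on the input `f` (if the algorithm does not stop before). -/
def values : ℕ → List ℝ
  | 0 => []
  | i + 1 => values i ++ [f (A.point (values i))]

/-- The sample point used for evaluation number `i` (counting from `0`). -/
def samplePoint (i : ℕ) : X := A.point (A.values f i)

/-- The number of function evaluations performed on the input `f`; it is `⊤` if the algorithm
never stops. -/
def numEvals : ℕ∞ := ⨅ (n : ℕ) (_ : A.halt (A.values f n)), (n : ℕ∞)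

/-- The result for the input `f` (meaningful only if the algorithm stops on `f`). -/
def result : ℝ := A.output (A.values f (A.numEvals f).toNat)

/-- The cost for the input `f`: the sum of the cost of all evaluations that are performed. -/
def cost (c : X → ℝ≥0∞) : ℝ≥0∞ :=
  ∑' i : ℕ, if (i : ℕ∞) < A.numEvals f then c (A.samplePoint f i) else 0

end DetAlgorithm

/-- A randomized algorithm: a probability space and a deterministic algorithm for each of its
elements. -/
structure RandAlgorithm (X : Type) where
  Ω : Type u
  [mΩ : MeasurableSpace Ω]
  P : Measure Ω
  [prob : IsProbabilityMeasure P]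
  alg : Ω → DetAlgorithm X

attribute [instance] RandAlgorithm.mΩ RandAlgorithm.prob

namespace RandAlgorithm

variable {X : Type} (Q : RandAlgorithm.{u} X)

/-- The class of all randomized algorithms on the function class `H` with respect to the cost
function `c`: for every `f ∈ H` the algorithm stops almost surely, its output is a
square-integrable random variable, and its cost is a random variable. -/
def ran (c : X → ℝ≥0∞) (H : Set (X → ℝ)) : Set (RandAlgorithm.{u} X) :=
  {Q | ∀ f ∈ H, (∀ᵐ w ∂Q.P, (Q.alg w).numEvals f < ⊤) ∧
    MemLp (fun w => (Q.alg w).result f) 2 Q.P ∧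
    AEMeasurable (fun w => (Q.alg w).cost f c) Q.P}

/-- The expected cost for the input `f`. -/
def expectedCost (c : X → ℝ≥0∞) (f : X → ℝ) : ℝ≥0∞ :=
  ∫⁻ w, (Q.alg w).cost f c ∂Q.P

/-- The worst case cost on the class `F` of integrands. -/
def worstCost (c : X → ℝ≥0∞) (F : Set (X → ℝ)) : ℝ≥0∞ :=
  ⨆ f ∈ F, Q.expectedCost c f

/-- The randomized worst case error for the approximation of the functional `I` on `F`. -/
def error (I : (X → ℝ) → ℝ) (F : Set (X → ℝ)) : ℝ≥0∞ :=
  (⨆ f ∈ F, ∫⁻ w, ENNReal.ofReal ((I f - (Q.alg w).result f) ^ 2) ∂Q.P) ^ (1 / 2 : ℝ)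

/-- The `N`-th minimal error within the class `𝒜` of algorithms. -/
def minError (𝒜 : Set (RandAlgorithm.{u} X)) (c : X → ℝ≥0∞) (I : (X → ℝ) → ℝ)
    (F : Set (X → ℝ)) (N : ℝ≥0) : ℝ≥0∞ :=
  ⨅ (Q : RandAlgorithm.{u} X) (_ : Q ∈ 𝒜 ∧ Q.worstCost c F ≤ N), Q.error I F

/-- The `ε`-complexity within the class `𝒜` of algorithms. -/
def complexity (𝒜 : Set (RandAlgorithm.{u} X)) (c : X → ℝ≥0∞) (I : (X → ℝ) → ℝ)
    (F : Set (X → ℝ)) (ε : ℝ) : ℝ≥0∞ :=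
  ⨅ (Q : RandAlgorithm.{u} X) (_ : Q ∈ 𝒜 ∧ Q.error I F ≤ ENNReal.ofReal ε), Q.worstCost c F

/-- The exponent of strong polynomial tractability: the infimum of all `p ≥ 0` such that, for some
`C > 0`, the `ε`-complexity is at most `C ε⁻ᵖ` for all `ε > 0`; it is `∞` if there is no such
`p`. -/
def tractabilityExponent (𝒜 : Set (RandAlgorithm.{u} X)) (c : X → ℝ≥0∞) (I : (X → ℝ) → ℝ)
    (F : Set (X → ℝ)) : ℝ≥0∞ :=
  ⨅ (p : ℝ≥0) (_ : ∃ C : ℝ, 0 < C ∧ ∀ ε : ℝ, 0 < ε →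
    complexity 𝒜 c I F ε ≤ ENNReal.ofReal (C * ε ^ (-(p : ℝ)))), (p : ℝ≥0∞)

end RandAlgorithm

/-! ### The setting -/

/-- The data of the infinite-dimensional integration problem: a Borel set `D`, a measurable
reproducing kernel `k` on `D` with anchor `a`, a probability measure `ρ` on `D`, weights `γ`
indexed by the finite subsets of `ℕ+ = {1, 2, …}`, and a cost function `dollar`. -/
structure Setting where
  D : Set ℝ
  measurableSet_D : MeasurableSet D
  k : Matrix D D ℝ
  measurable_k : Measurable fun z : D × D => k z.1 z.2
  posSemidef_k : k.PosSemidef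
  a : D
  k_anchor : k a a = 0
  ρ : Measure D
  isProbabilityMeasure_ρ : IsProbabilityMeasure ρ
  integrable_diag : Integrable (fun x => k x x) ρ
  C₀_pos : 0 < ∫ x, ∫ y, k x y ∂ρ ∂ρ
  γ : Finset ℕ+ → ℝ
  γ_nonneg : ∀ u, 0 ≤ γ u
  summable_γ : Summable fun u : Finset ℕ+ => γ u * (∫ x, k x x ∂ρ) ^ u.card
  dollar : ℕ → ℝ≥0∞
  dollar_mono : Monotone dollar
  one_le_dollar : ∀ n, 1 ≤ dollar n

attribute [instance] Setting.isProbabilityMeasure_ρ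

namespace Setting

variable (S : Setting)

/-- The sequences `𝐱 ∈ D^ℕ`. -/
abbrev Point : Type := ℕ+ → S.D

/-- `C₀ = ∫∫ k(x,y) ρ(dx) ρ(dy)`. -/
def C₀ : ℝ := ∫ x, ∫ y, S.k x y ∂S.ρ ∂S.ρ

/-- The product kernel `k_u`. -/
def kProd (u : Finset ℕ+) : Matrix S.Point S.Point ℝ :=
  Matrix.of fun x y => ∏ j ∈ u, S.k (x j) (y j)

/-- The domain `𝒳` of the functions of infinitely many variables. -/
def domain : Set S.Point := {x | Summable fun u : Finset ℕ+ => S.γ u * S.kProd u x x}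

/-- The kernel `K_γ = ∑ᵤ γ_u k_u` on `𝒳`. -/
def kernel : Matrix S.domain S.domain ℝ :=
  Matrix.of fun x y => ∑' u : Finset ℕ+, S.γ u * S.kProd u x y

theorem kProd_posSemidef (u : Finset ℕ+) : (S.kProd u).PosSemidef := by
  classical
  induction u using Finset.induction_on with
  | empty =>
    have h : S.kProd ∅ = Matrix.vecMulVec (fun _ => 1) (star fun _ => (1 : ℝ)) := by
      ext x y; simp [kProd, Matrix.vecMulVec]
    rw [h]
    refine ⟨?_, fun v => ?_⟩
    · ext x y; simp [Matrix.vecMulVec]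
    · simp only [Matrix.vecMulVec_apply, star_trivial, mul_one]
      have : (v.sum fun _ xi => v.sum fun _ xj => xi * xj) = (v.sum fun _ xi => xi) ^ 2 := by
        simp [Finsupp.sum, sq, Finset.sum_mul_sum]
      rw [this]; positivity
  | insert j u hj ih =>
    have h : S.kProd (insert j u) =
        Matrix.hadamard (S.k.submatrix (fun x : S.Point => x j) fun x : S.Point => x j)
          (S.kProd u) := by
      ext x y; simp [kProd, Finset.prod_insert hj, Matrix.hadamard]
    rw [h]
    exact (S.posSemidef_k.submatrix _).hadamard ih

theorem summable_kernel (x y : S.domain) :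
    Summable fun u : Finset ℕ+ => S.γ u * S.kProd u x y := by
  classical
  refine Summable.of_norm_bounded ((x.2.add y.2)) fun u => ?_
  have hp := S.kProd_posSemidef u
  have hs : S.kProd u (y : S.Point) x = S.kProd u (x : S.Point) y := by
    simpa using hp.1.apply (x : S.Point) (y : S.Point)
  have key : ∀ t : ℝ, 0 ≤ S.kProd u (x : S.Point) x + 2 * t * S.kProd u (x : S.Point) y
      + t ^ 2 * S.kProd u (y : S.Point) y := by
    intro t
    have h2 := (Matrix.posSemidef_iff_dotProduct_mulVec.mp
      (hp.submatrix (![(x : S.Point), y] : Fin 2 → S.Point))).2 ![1, t]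
    simp [Matrix.mulVec, dotProduct, Fin.sum_univ_two, hs] at h2
    linarith
  have h1 := key 1
  have h3 := key (-1)
  have hx : 0 ≤ S.kProd u (x : S.Point) x := hp.diag_nonneg
  have hy : 0 ≤ S.kProd u (y : S.Point) y := hp.diag_nonneg
  rw [Real.norm_eq_abs, abs_mul, abs_of_nonneg (S.γ_nonneg u), ← mul_add]
  refine mul_le_mul_of_nonneg_left ?_ (S.γ_nonneg u)
  rw [abs_le]; constructor <;> linarith

theorem kernel_posSemidef : S.kernel.PosSemidef := by
  have hs : ∀ x y : S.domain, Tendsto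
      (fun F : Finset (Finset ℕ+) => ∑ u ∈ F, S.γ u * S.kProd u x y) atTop (𝓝 (S.kernel x y)) :=
    fun x y => (S.summable_kernel x y).hasSum
  have hF : ∀ F : Finset (Finset ℕ+), (∑ u ∈ F, S.γ u •
      (S.kProd u).submatrix ((↑) : S.domain → S.Point) (↑)).PosSemidef := fun F =>
    Matrix.posSemidef_sum F fun u _ => ((S.kProd_posSemidef u).submatrix _).smul (S.γ_nonneg u)
  refine ⟨?_, fun v => ?_⟩
  · ext x y
    have h : S.kernel y x = S.kernel x y := by
      refine tsum_congr fun u => ?_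
      have := (S.kProd_posSemidef u).1.apply (x : S.Point) (y : S.Point)
      simp only [star_trivial] at this
      rw [this]
    simpa using h
  · refine ge_of_tendsto' (x := atTop) (f := fun F : Finset (Finset ℕ+) => v.sum fun i xi =>
      v.sum fun j xj => star xi * (∑ u ∈ F, S.γ u * S.kProd u i j) * xj) ?_ fun F => ?_
    · exact tendsto_finsetSum _ fun i _ => tendsto_finsetSum _ fun j _ =>
        ((hs i j).const_mul _).mul_const _
    · have := (hF F).2 v
      simpa [Matrix.sum_apply] using this

/-- The space `ℋ_γ = H(K_γ)`, its elements being extended by `0` from `𝒳` to `D^ℕ`. -/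
def space : Set (S.Point → ℝ) :=
  (fun f => Function.extend (Subtype.val : S.domain → S.Point) f 0) ''
    rkhs S.kernel S.kernel_posSemidef

/-- The norm unit ball `B_γ = B(K_γ)`, its elements being extended by `0` from `𝒳` to `D^ℕ`. -/
def ball : Set (S.Point → ℝ) :=
  (fun f => Function.extend (Subtype.val : S.domain → S.Point) f 0) ''
    rkhsBall S.kernel S.kernel_posSemidef

/-- The integral `I(f) = ∫_𝒳 f dμ`, where `μ` is the infinite product of `ρ` on `D^ℕ`. -/
def integral (f : S.Point → ℝ) : ℝ :=
  ∫ x in S.domain, f x ∂(Measure.infinitePi fun _ : ℕ+ => S.ρ)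

/-- The affine subspace `𝒳_{v,a}` of the sequences that equal the anchor outside `v`. -/
def affine (v : Finset ℕ+) : Set S.Point := {x | ∀ j ∉ v, x j = S.a}

/-- The cost function `c_a` of the unrestricted subspace sampling model. -/
def unrCost (x : S.Point) : ℝ≥0∞ := ⨅ (v : Finset ℕ+) (_ : x ∈ S.affine v), S.dollar v.card

/-- The class `𝒜^{res-ω}`: there are `n` and `v₁, …, vₙ` with `|vᵢ| ≤ ω` such that for every
`f ∈ ℋ_γ` the algorithm (almost surely) performs exactly `n` evaluations of `f`, the `i`-th sample
point being taken from `𝒳_{vᵢ,a}`, and the expected cost is `∑ᵢ $(|vᵢ|)`. -/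
def resOmega (ω : ℕ) : Set (RandAlgorithm.{u} S.Point) :=
  {Q | Q ∈ RandAlgorithm.ran S.unrCost S.space ∧
    ∃ (n : ℕ) (v : Fin n → Finset ℕ+), (∀ i, (v i).card ≤ ω) ∧
      ∀ f ∈ S.space,
        (∀ᵐ w ∂Q.P, (Q.alg w).numEvals f = n ∧
          ∀ i : Fin n, (Q.alg w).samplePoint f i ∈ S.affine (v i)) ∧
        Q.expectedCost S.unrCost f = ∑ i, S.dollar (v i).card}

/-- The exponent of tractability `p^{res-ω}_unr`. -/
def pResOmega (ω : ℕ) : ℝ≥0∞ :=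
  RandAlgorithm.tractabilityExponent (S.resOmega.{u} ω) S.unrCost S.integral S.ball

/-! ### Univariate integration -/

/-- The univariate kernel `γ_{1} k`. -/
def univKernel : Matrix S.D S.D ℝ := S.γ {1} • S.k

theorem univKernel_posSemidef : S.univKernel.PosSemidef :=
  S.posSemidef_k.smul (S.γ_nonneg _)

/-- The `N`-th minimal error `e^ran(N, B(γ_{1} k))` of univariate integration with respect to `ρ`,
where every function evaluation costs `$(1)`. -/
def univMinError (N : ℝ≥0) : ℝ≥0∞ :=
  RandAlgorithm.minError
    (RandAlgorithm.ran.{u} (fun _ : S.D => S.dollar 1)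
      (rkhs S.univKernel S.univKernel_posSemidef))
    (fun _ => S.dollar 1) (fun f => ∫ x, f x ∂S.ρ)
    (rkhsBall S.univKernel S.univKernel_posSemidef) N

end Setting

/-! ### Decay of the weights -/

/-- The cut-off weights of order `σ`. -/
def cutOff (γ : Finset ℕ+ → ℝ) (σ : ℕ) (u : Finset ℕ+) : ℝ := if u.card ≤ σ then γ u else 0

/-- The non-empty sets with positive weight. -/
def activeSets (γ : Finset ℕ+ → ℝ) : Set (Finset ℕ+) := {u | u.Nonempty ∧ 0 < γ u}

/-- `u 0, u 1, …` lists the distinct non-empty sets with positive weight `γ` such that the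
weights `γ̂_u = γ_u C₀^|u|` are non-increasing. -/
def IsOrdering (γ : Finset ℕ+ → ℝ) (C₀ : ℝ) (u : ℕ → Finset ℕ+) : Prop :=
  Function.Injective u ∧ Set.range u = activeSets γ ∧
    Antitone fun j => γ (u j) * C₀ ^ (u j).card

/-- `sup {p ∈ ℝ | lim_{j → ∞} γ̂_{u_j} j^p = 0}`, where `u_1, u_2, …` are the non-empty sets with
positive weight, ordered by non-increasing `γ̂`. If there are only finitely many such sets, then
the condition on `p` is void. -/
def decay (γ : Finset ℕ+ → ℝ) (C₀ : ℝ) : EReal :=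
  ⨆ (p : ℝ) (_ : (activeSets γ).Finite ∨ ∃ u, IsOrdering γ C₀ u ∧
    Tendsto (fun j : ℕ => γ (u j) * C₀ ^ (u j).card * ((j : ℝ) + 1) ^ p) atTop (𝓝 0)), (p : EReal)

end InfInt

end

/-! Both lower bounds hold for every `p` admitted in the infimum that defines the exponent.

The decay bound uses fooling functions. Let h(x) = ∫ k(x,y) ρ(dy) be the mean embedding of ρ. It has
squared norm C₀ in H(k) and integral C₀, and h(a) = 0 because k(a,a) = 0. Hence C₀k − h⊗h is
positive semi-definite, and Schur products carry this over to k_u (`smul_kProd_sub_posSemidef`). For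
a finite family T, the function f_T = ∑_{u∈T} γ_u ∏_{j∈u} h(x_j) therefore has squared norm at most
mass(T) = ∑_{u∈T} γ_u C₀^|u|, and its integral is mass(T) (`meanSum_mem_ball`, `integral_meanSum`).
It vanishes on 𝒳_{v,a} unless some u ∈ T lies in v. So an algorithm with index sets v₁,…,vₙ sees
only zeros on ±f_T/√mass(T) if no u ∈ T lies in any vᵢ, and its squared error is at least mass(T)
(`exists_uncovered_le_error`). The vᵢ have at most n·2^ω subsets, and n is at most the cost. If
comp(ε) ≤ Cε⁻ᵖ, then all families outside some O(ε⁻ᵖ) sets have mass at most ε². For p > 0 this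
gives γ̂_{u_j} = O(j^{−(2/p+1)}), that is, decay ≥ 2/p + 1 (`two_div_decay_le`).

The bound 2/α holds because f ↦ f(x₁) embeds B(γ_{1}k) into B_γ and preserves integrals, so an
algorithm for B_γ yields a univariate one whose cost is larger by at most the factor $(1)
(`univMinError_le`, `two_div_le_of_univMinError`). -/

namespace InfInt

/-! ### Reproducing kernel Hilbert spaces described by quadratic forms -/

section Kernels

variable {X : Type}

/-- The quadratic form of a kernel on finitely supported coefficient vectors. -/
def quadForm (K : Matrix X X ℝ) (v : X →₀ ℝ) : ℝ :=
  v.sum fun i xi => v.sum fun j xj => xi * K i j * xj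

theorem quadForm_nonneg {K : Matrix X X ℝ} (hK : K.PosSemidef) (v : X →₀ ℝ) :
    0 ≤ quadForm K v := by
  simpa [quadForm] using hK.2 v

theorem quadForm_smul (c : ℝ) (K : Matrix X X ℝ) (v : X →₀ ℝ) :
    quadForm (c • K) v = c * quadForm K v := by
  simp only [quadForm, Finsupp.sum, Finset.mul_sum, Matrix.smul_apply, smul_eq_mul]
  refine Finset.sum_congr rfl fun i _ => Finset.sum_congr rfl fun j _ => by ring

theorem quadForm_submatrix {Y : Type} (K : Matrix Y Y ℝ) (φ : X → Y) (v : X →₀ ℝ) :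
    quadForm (K.submatrix φ φ) v = quadForm K (v.mapDomain φ) := by
  unfold quadForm
  rw [Finsupp.sum_mapDomain_index (by simp) (by simp [add_mul, Finsupp.sum_add])]
  refine Finsupp.sum_congr fun i _ => ?_
  rw [Finsupp.sum_mapDomain_index (by simp) (by simp [mul_add])]
  rfl

theorem apply_comm_of_posSemidef {K : Matrix X X ℝ} (hK : K.PosSemidef) (x y : X) :
    K x y = K y x := by
  simpa using (hK.1.apply x y).symm

theorem abs_apply_le_of_posSemidef {K : Matrix X X ℝ} (hK : K.PosSemidef) (x y : X) :
    |K x y| ≤ (K x x + K y y) / 2 := by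
  have hs : K y x = K x y := apply_comm_of_posSemidef hK y x
  have key : ∀ t : ℝ, 0 ≤ K x x + 2 * t * K x y + t ^ 2 * K y y := by
    intro t
    have h2 := (Matrix.posSemidef_iff_dotProduct_mulVec.mp
      (hK.submatrix (![x, y] : Fin 2 → X))).2 ![1, t]
    simp [Matrix.mulVec, dotProduct, Fin.sum_univ_two, hs] at h2
    linarith
  have h1 := key 1
  have h3 := key (-1)
  rw [abs_le]; constructor <;> linarith

theorem apply_eq_zero_of_posSemidef {K : Matrix X X ℝ} (hK : K.PosSemidef) {x : X}
    (hx : K x x = 0) (y : X) : K x y = 0 := by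
  have hs : K y x = K x y := apply_comm_of_posSemidef hK y x
  have key : ∀ t : ℝ, 0 ≤ t ^ 2 * K x x + 2 * t * K x y + K y y := by
    intro t
    have h2 := (Matrix.posSemidef_iff_dotProduct_mulVec.mp
      (hK.submatrix (![x, y] : Fin 2 → X))).2 ![t, 1]
    simp [Matrix.mulVec, dotProduct, Fin.sum_univ_two, hs] at h2
    linarith
  by_contra hne
  -- With K x x = 0 the form is affine in t, and this t gives it the value −1.
  have := key (-(K y y + 1) / (2 * K x y))
  rw [hx] at this
  have h2 : 2 * (-(K y y + 1) / (2 * K x y)) * K x y = -(K y y + 1) := by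
    field_simp
  rw [h2] at this
  linarith

section Hilbert

variable (K : Matrix X X ℝ) [Fact (opKernel K).PosSemidef]

/-- The linear combination of kernel sections with a given coefficient vector. -/
noncomputable def sectionSum : (X →₀ ℝ) →ₗ[ℝ] RKHS.OfKernel (opKernel K) :=
  Finsupp.linearCombination ℝ fun x => RKHS.kerFun (RKHS.OfKernel (opKernel K)) x (1 : ℝ)

theorem kerFun_one_apply (x y : X) :
    RKHS.kerFun (RKHS.OfKernel (opKernel K)) y (1 : ℝ) x = K x y := by
  rw [RKHS.kerFun_apply, RKHS.OfKernel.kernel_ofKernel]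
  simp [opKernel]

theorem inner_sectionSum (g : RKHS.OfKernel (opKernel K)) (v : X →₀ ℝ) :
    inner ℝ g (sectionSum K v) = v.sum fun x c => c * g x := by
  simp [sectionSum, Finsupp.linearCombination_apply, Finsupp.sum, inner_sum, inner_smul_right]

theorem norm_sectionSum_sq (v : X →₀ ℝ) : ‖sectionSum K v‖ ^ 2 = quadForm K v := by
  rw [← real_inner_self_eq_norm_sq, inner_sectionSum]
  refine Finsupp.sum_congr fun x _ => ?_
  have : (sectionSum K v) x = v.sum fun y c => c * K x y := by
    have := RKHS.kerFun_inner x (1 : ℝ) (sectionSum K v)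
    rw [inner_sectionSum] at this
    rw [show (sectionSum K v) x = inner ℝ (1 : ℝ) ((sectionSum K v) x) by simp, ← this]
    refine Finsupp.sum_congr fun y _ => ?_
    have hf : (opKernel K).PosSemidef := Fact.out
    have h := congrArg (fun T : ℝ →L[ℝ] ℝ => T 1) (hf.1.apply x y)
    rw [kerFun_one_apply]
    simp [opKernel, star_smul] at h
    rw [← h]
    congr 1
    have h1 : star (ContinuousLinearMap.id ℝ ℝ) = ContinuousLinearMap.id ℝ ℝ :=
      star_one (ℝ →L[ℝ] ℝ)
    simp [h1]
  rw [this, Finsupp.mul_sum]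
  refine Finsupp.sum_congr fun y _ => by ring

/-- Membership in a ball becomes a domination of quadratic forms, which is easy to pull back and to
sum. One direction is Cauchy–Schwarz against `sectionSum K v`. Conversely, the bound makes the
functional with coefficients f well defined on the span of the kernel sections; Hahn–Banach and
Riesz then give the element g. -/
theorem exists_ofKernel_iff {f : X → ℝ} {r : ℝ} (hr : 0 ≤ r) :
    (∃ g : RKHS.OfKernel (opKernel K), ‖g‖ ≤ r ∧ ∀ x, f x = g x) ↔
      ∀ v : X →₀ ℝ, (v.sum fun x c => c * f x) ^ 2 ≤ r ^ 2 * quadForm K v := by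
  constructor
  · rintro ⟨g, hg, hf⟩ v
    have h1 : (v.sum fun x c => c * f x) = inner ℝ g (sectionSum K v) := by
      rw [inner_sectionSum]
      exact Finsupp.sum_congr fun x _ => by rw [hf]
    rw [h1, ← norm_sectionSum_sq, ← mul_pow]
    refine sq_le_sq' ?_ ?_
    · have := neg_le_of_abs_le (abs_real_inner_le_norm g (sectionSum K v))
      have h2 := mul_le_mul_of_nonneg_right hg (norm_nonneg (sectionSum K v))
      linarith
    · have := le_of_abs_le (abs_real_inner_le_norm g (sectionSum K v))
      have h2 := mul_le_mul_of_nonneg_right hg (norm_nonneg (sectionSum K v))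
      linarith
  · intro h
    let ℓ : (X →₀ ℝ) →ₗ[ℝ] ℝ := Finsupp.linearCombination ℝ f
    have hℓ : ∀ v, ℓ v = v.sum fun x c => c * f x := fun v => by
      simp [ℓ, Finsupp.linearCombination_apply]
    have hb : ∀ v, ‖ℓ v‖ ≤ r * ‖sectionSum K v‖ := fun v => by
      refine abs_le_of_sq_le_sq ?_ (by positivity)
      rw [mul_pow, norm_sectionSum_sq, hℓ]
      exact h v
    let T := (sectionSum K).rangeRestrict
    -- The bound kills ℓ on combinations of sections that vanish, so ℓ descends to the range of
    -- `sectionSum K`.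
    have hker : LinearMap.ker T ≤ LinearMap.ker ℓ := fun v hv => by
      rw [LinearMap.mem_ker] at hv ⊢
      have h0 : sectionSum K v = 0 := by
        have := congrArg Subtype.val hv
        simpa [T] using this
      have := hb v
      rw [h0, norm_zero, mul_zero] at this
      exact norm_le_zero_iff.mp this
    obtain ⟨inv, hinv⟩ := T.exists_rightInverse_of_surjective (LinearMap.range_rangeRestrict _)
    have hinv' : ∀ y, sectionSum K (inv y) = y := fun y => by
      have := congrArg Subtype.val (LinearMap.congr_fun hinv y)
      simpa [T] using this
    let ψ : StrongDual ℝ (LinearMap.range (sectionSum K)) :=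
      (ℓ ∘ₗ inv).mkContinuous r fun y => by
        have := hb (inv y)
        rwa [hinv'] at this
    have hψ : ∀ v, ψ ⟨sectionSum K v, v, rfl⟩ = ℓ v := fun v => by
      have h0 : inv ⟨sectionSum K v, v, rfl⟩ - v ∈ LinearMap.ker T := by
        rw [LinearMap.mem_ker]
        ext1
        simp [T, hinv']
      have := hker h0
      rw [LinearMap.mem_ker, map_sub, sub_eq_zero] at this
      exact this
    obtain ⟨Ψ, hΨ, hn⟩ := exists_extension_norm_eq _ ψ
    refine ⟨(InnerProductSpace.toDual ℝ _).symm Ψ, ?_, fun x => ?_⟩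
    · rw [LinearIsometryEquiv.norm_map, hn]
      exact LinearMap.mkContinuous_norm_le _ hr _
    · have h1 := hψ (Finsupp.single x 1)
      rw [← hΨ, ← InnerProductSpace.toDual_symm_apply (𝕜 := ℝ) (y := Ψ), inner_sectionSum] at h1
      rw [hℓ] at h1
      simpa using h1.symm

end Hilbert

theorem mem_rkhs_iff {K : Matrix X X ℝ} (hK : K.PosSemidef) {f : X → ℝ} :
    f ∈ rkhs K hK ↔ ∃ r : ℝ, 0 ≤ r ∧
      ∀ v : X →₀ ℝ, (v.sum fun x c => c * f x) ^ 2 ≤ r ^ 2 * quadForm K v := by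
  have : Fact (opKernel K).PosSemidef := ⟨opKernel_posSemidef hK⟩
  constructor
  · rintro ⟨g, hg⟩
    exact ⟨‖g‖, norm_nonneg g, (exists_ofKernel_iff K (norm_nonneg g)).mp ⟨g, le_rfl, hg⟩⟩
  · rintro ⟨r, hr, h⟩
    obtain ⟨g, -, hg⟩ := (exists_ofKernel_iff K hr).mpr h
    exact ⟨g, hg⟩

theorem mem_rkhsBall_iff {K : Matrix X X ℝ} (hK : K.PosSemidef) {f : X → ℝ} :
    f ∈ rkhsBall K hK ↔
      ∀ v : X →₀ ℝ, (v.sum fun x c => c * f x) ^ 2 ≤ quadForm K v := by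
  have : Fact (opKernel K).PosSemidef := ⟨opKernel_posSemidef hK⟩
  refine (exists_ofKernel_iff K (f := f) zero_le_one).trans ?_
  simp

theorem rkhsBall_subset_rkhs {K : Matrix X X ℝ} (hK : K.PosSemidef) :
    rkhsBall K hK ⊆ rkhs K hK := by
  rintro f ⟨g, -, hg⟩
  exact ⟨g, hg⟩

section Mean

variable [MeasurableSpace X] {K : Matrix X X ℝ}

/-- Norm convergence implies pointwise convergence, so the measurable elements form a closed
subspace. It contains the kernel sections, whose span is dense. -/
theorem measurable_ofKernel [Fact (opKernel K).PosSemidef]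
    (hm : Measurable fun z : X × X => K z.1 z.2) (g : RKHS.OfKernel (opKernel K)) :
    Measurable fun x => g x := by
  let p : Submodule ℝ (RKHS.OfKernel (opKernel K)) :=
    { carrier := {g | Measurable fun x => g x}
      add_mem' := fun {a b} ha hb => by
        simp only [Set.mem_ofPred_eq, RKHS.coe_add, Pi.add_apply] at *
        exact ha.add hb
      zero_mem' := by simp [measurable_const]
      smul_mem' := fun c a ha => by
        simp only [Set.mem_ofPred_eq, RKHS.coe_smul, Pi.smul_apply] at *
        exact ha.const_smul c }
  have hc : IsClosed (p : Set (RKHS.OfKernel (opKernel K))) := by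
    refine IsSeqClosed.isClosed fun u g hu hg => ?_
    refine measurable_of_tendsto_metrizable (f := fun n x => u n x) hu ?_
    rw [tendsto_pi_nhds]
    intro x
    exact ((RKHS.continuous_eval x).tendsto g).comp hg
  have hp : Submodule.span ℝ {RKHS.kerFun (RKHS.OfKernel (opKernel K)) x v | (x) (v)} ≤ p := by
    rw [Submodule.span_le]
    rintro _ ⟨x, v, rfl⟩
    have : ∀ y, RKHS.kerFun (RKHS.OfKernel (opKernel K)) x v y = v * K y x := fun y => by
      rw [RKHS.kerFun_apply, RKHS.OfKernel.kernel_ofKernel]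
      simp [opKernel, mul_comm]
    change Measurable _
    simp only [this]
    exact (hm.comp (measurable_id.prodMk measurable_const)).const_mul v
  have htop := Submodule.topologicalClosure_minimal _ hp hc
  rw [RKHS.kerFun_dense] at htop
  exact htop (x := g) trivial

/-- The quadratic form of `C K - h ⊗ h` is nonnegative, where `h` is the mean embedding of `ν` and
`C` its squared norm. -/
theorem sq_sum_mean_le (hK : K.PosSemidef) (hm : Measurable fun z : X × X => K z.1 z.2)
    (ν : Measure X) [IsProbabilityMeasure ν] (hi : Integrable (fun x => K x x) ν) (v : X →₀ ℝ) :
    (v.sum fun x c => c * ∫ y, K x y ∂ν) ^ 2 ≤ (∫ x, ∫ y, K x y ∂ν ∂ν) * quadForm K v := by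
  have : Fact (opKernel K).PosSemidef := ⟨opKernel_posSemidef hK⟩
  have hd : ∀ x, 0 ≤ K x x := fun x => hK.diag_nonneg
  have hdm : Measurable fun x => K x x := hm.comp (measurable_id.prodMk measurable_id)
  have hsq : Integrable (fun x => √(K x x)) ν := by
    refine Integrable.mono' ((integrable_const 1).add hi) hdm.sqrt.aestronglyMeasurable ?_
    refine ae_of_all _ fun x => ?_
    rw [Real.norm_of_nonneg (Real.sqrt_nonneg _)]
    refine Real.sqrt_le_iff.mpr ⟨?_, ?_⟩
    · have := hd x
      simp only [Pi.add_apply]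
      linarith
    · have := hd x
      simp only [Pi.add_apply]
      nlinarith
  have hb : ∀ (g : RKHS.OfKernel (opKernel K)) (x : X), ‖g x‖ ≤ ‖g‖ * √(K x x) := fun g x => by
    refine (RKHS.norm_apply_le g x).trans_eq ?_
    rw [RKHS.OfKernel.kernel_ofKernel]
    simp [opKernel, norm_smul, abs_of_nonneg (hd x)]
  have hgi : ∀ g : RKHS.OfKernel (opKernel K), Integrable (fun x => g x) ν := fun g =>
    Integrable.mono' (hsq.const_mul ‖g‖) (measurable_ofKernel hm g).aestronglyMeasurable
      (ae_of_all _ (hb g))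
  -- Integration is bounded on H(K) because |g(x)| ≤ ‖g‖ √K(x,x). Its Riesz representer h is the
  -- mean embedding, and ‖h‖² = ∫ h dν is the double integral.
  let L : StrongDual ℝ (RKHS.OfKernel (opKernel K)) :=
    LinearMap.mkContinuous
      { toFun := fun g => ∫ x, g x ∂ν
        map_add' := fun a b => by
          simp only [RKHS.coe_add, Pi.add_apply]
          exact integral_add (hgi a) (hgi b)
        map_smul' := fun c a => by
          simp only [RKHS.coe_smul, Pi.smul_apply, smul_eq_mul, RingHom.id_apply]
          exact integral_const_mul _ _ } (∫ x, √(K x x) ∂ν) fun g => by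
      refine (norm_integral_le_of_norm_le (hsq.const_mul ‖g‖) (ae_of_all _ (hb g))).trans_eq ?_
      rw [integral_const_mul, mul_comm]
  have hL : ∀ g, L g = ∫ x, g x ∂ν := fun g => rfl
  let h := (InnerProductSpace.toDual ℝ (RKHS.OfKernel (opKernel K))).symm L
  have hh : ∀ g, inner ℝ h g = ∫ x, g x ∂ν := fun g => by
    rw [← hL, InnerProductSpace.toDual_symm_apply]
  have hx : ∀ x, h x = ∫ y, K x y ∂ν := fun x => by
    have h1 := hh (RKHS.kerFun _ x (1 : ℝ))
    rw [RKHS.inner_kerFun] at h1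
    simp only [kerFun_one_apply] at h1
    rw [show h x = inner ℝ (h x) (1 : ℝ) by simp, h1]
    exact integral_congr_ae (ae_of_all _ fun y => apply_comm_of_posSemidef hK y x)
  have hnorm : ‖h‖ ^ 2 = ∫ x, ∫ y, K x y ∂ν ∂ν := by
    rw [← real_inner_self_eq_norm_sq, hh]
    simp only [hx]
  rw [← hnorm]
  exact (exists_ofKernel_iff K (norm_nonneg h)).mp ⟨h, le_rfl, fun x => (hx x).symm⟩ v

end Mean

end Kernels

/-! ### Domination of rank one kernels -/

section RankOne

variable {X : Type}

/-- The kernel `h ⊗ h`. -/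
def rankOne (h : X → ℝ) : Matrix X X ℝ := Matrix.of fun x y => h x * h y

theorem quadForm_rankOne (h : X → ℝ) (v : X →₀ ℝ) :
    quadForm (rankOne h) v = (v.sum fun x c => c * h x) ^ 2 := by
  simp only [quadForm, rankOne, Finsupp.sum, sq, Finset.sum_mul_sum, Matrix.of_apply]
  refine Finset.sum_congr rfl fun i _ => Finset.sum_congr rfl fun j _ => by ring

theorem quadForm_sub (K L : Matrix X X ℝ) (v : X →₀ ℝ) :
    quadForm (K - L) v = quadForm K v - quadForm L v := by
  simp only [quadForm, Finsupp.sum, Matrix.sub_apply, ← Finset.sum_sub_distrib]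
  refine Finset.sum_congr rfl fun i _ => Finset.sum_congr rfl fun j _ => by ring

theorem posSemidef_of_quadForm_nonneg {K : Matrix X X ℝ} (hs : ∀ x y, K x y = K y x)
    (hq : ∀ v, 0 ≤ quadForm K v) : K.PosSemidef := by
  refine ⟨?_, fun v => by simpa [quadForm] using hq v⟩
  ext x y
  simpa using hs y x

theorem rankOne_posSemidef (h : X → ℝ) : (rankOne h).PosSemidef :=
  posSemidef_of_quadForm_nonneg (fun x y => by simp [rankOne, mul_comm]) fun v => by
    rw [quadForm_rankOne]; positivity

/-- The right-hand side is the norm bound ‖h‖² ≤ C in H(K); the left-hand side is its form that can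
be multiplied over coordinates. -/
theorem smul_sub_rankOne_posSemidef_iff {K : Matrix X X ℝ} (hK : K.PosSemidef) {C : ℝ}
    {h : X → ℝ} : (C • K - rankOne h).PosSemidef ↔
      ∀ v : X →₀ ℝ, (v.sum fun x c => c * h x) ^ 2 ≤ C * quadForm K v := by
  constructor
  · intro H v
    have := quadForm_nonneg H v
    rw [quadForm_sub, quadForm_smul, quadForm_rankOne] at this
    linarith
  · intro H
    refine posSemidef_of_quadForm_nonneg (fun x y => ?_) fun v => ?_
    · simp [rankOne, apply_comm_of_posSemidef hK x y, mul_comm]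
    · rw [quadForm_sub, quadForm_smul, quadForm_rankOne]
      linarith [H v]

/-- Domination of rank one kernels is stable under Schur products. -/
theorem hadamard_sub_rankOne_posSemidef {K L : Matrix X X ℝ} (hL : L.PosSemidef)
    {f g : X → ℝ} (h₁ : (K - rankOne f).PosSemidef) (h₂ : (L - rankOne g).PosSemidef) :
    (Matrix.hadamard K L - rankOne fun x => f x * g x).PosSemidef := by
  -- Telescoping: both summands are Schur products of positive semi-definite kernels.
  have : Matrix.hadamard K L - (rankOne fun x => f x * g x) =
      Matrix.hadamard (K - rankOne f) L + Matrix.hadamard (rankOne f) (L - rankOne g) := by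
    ext x y
    simp [rankOne, Matrix.hadamard]
    ring
  rw [this]
  exact (h₁.hadamard hL).add ((rankOne_posSemidef f).hadamard h₂)

end RankOne

/-! ### The product measure and the domain 𝒳 -/

namespace Setting

variable (S : Setting)

/-- The infinite product of `ρ`. -/
noncomputable abbrev μ : Measure S.Point := Measure.infinitePi fun _ : ℕ+ => S.ρ

theorem integral_prod_μ {f : S.D → ℝ} (hf : Integrable f S.ρ) (u : Finset ℕ+) :
    Integrable (fun x : S.Point => ∏ j ∈ u, f (x j)) S.μ ∧
      ∫ x, ∏ j ∈ u, f (x j) ∂S.μ = (∫ x, f x ∂S.ρ) ^ u.card := by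
  have hi : Integrable (fun y : u → S.D => ∏ j, f (y j)) (Measure.pi fun _ : u => S.ρ) :=
    Integrable.fintype_prod fun _ => hf
  have he : (fun x : S.Point => ∏ j ∈ u, f (x j)) =
      fun x => (fun y : u → S.D => ∏ j, f (y j)) (u.restrict x) := by
    ext x
    exact (Finset.prod_coe_sort u fun j => f (x j)).symm
  rw [he]
  constructor
  · have hm : (S.μ).map u.restrict = Measure.pi fun _ : u => S.ρ :=
      Measure.infinitePi_map_restrict _
    rw [← hm] at hi
    exact hi.comp_measurable (Finset.measurable_restrict u)
  · refine (integral_restrict_infinitePi (μ := fun _ : ℕ+ => S.ρ) hi.1).trans ?_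
    rw [integral_fintype_prod_eq_pow]
    simp

/-- The mean of ∑ γ_u k_u(x,x) is ∑ γ_u M^|u| < ∞, so the series is finite almost everywhere. -/
theorem ae_mem_domain : ∀ᵐ x ∂S.μ, x ∈ S.domain := by
  have hnn : ∀ u (x : S.Point), 0 ≤ S.γ u * S.kProd u x x := fun u x =>
    mul_nonneg (S.γ_nonneg u) (S.kProd_posSemidef u).diag_nonneg
  have hi := fun u => S.integral_prod_μ S.integrable_diag u
  have hm : ∀ u, AEMeasurable (fun x => ENNReal.ofReal (S.γ u * S.kProd u x x)) S.μ :=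
    fun u => ((hi u).1.const_mul (S.γ u)).1.aemeasurable.ennreal_ofReal
  have h1 : ∫⁻ x, ∑' u, ENNReal.ofReal (S.γ u * S.kProd u x x) ∂S.μ < ⊤ := by
    rw [lintegral_tsum hm]
    have : ∀ u, ∫⁻ x, ENNReal.ofReal (S.γ u * S.kProd u x x) ∂S.μ =
        ENNReal.ofReal (S.γ u * (∫ x, S.k x x ∂S.ρ) ^ u.card) := fun u => by
      refine (ofReal_integral_eq_lintegral_ofReal ((hi u).1.const_mul (S.γ u))
        (ae_of_all _ (hnn u))).symm.trans ?_
      congr 1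
      exact (integral_const_mul _ _).trans (by rw [(hi u).2])
    simp only [this]
    exact S.summable_γ.tsum_ofReal_lt_top
  have h2 := ae_lt_top' (AEMeasurable.tsum hm) h1.ne
  filter_upwards [h2] with x hx
  exact (ENNReal.summable_toReal hx.ne).congr fun u => ENNReal.toReal_ofReal (hnn u x)

theorem integral_extend (f : S.Point → ℝ) :
    S.integral (Function.extend (Subtype.val : S.domain → S.Point) (fun x => f x) 0) =
      ∫ x, f x ∂S.μ := by
  unfold integral
  rw [Measure.restrict_eq_self_of_ae_mem S.ae_mem_domain]
  refine integral_congr_ae ?_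
  filter_upwards [S.ae_mem_domain] with x hx
  exact Subtype.val_injective.extend_apply (fun x : S.domain => f x) 0 ⟨x, hx⟩

/-! ### The mean embedding of `ρ` and its tensor products -/

/-- The function `x ↦ ∫ k(x,y) ρ(dy)`. -/
noncomputable def mean (x : S.D) : ℝ := ∫ y, S.k x y ∂S.ρ

theorem k_anchor_left (x : S.D) : S.k S.a x = 0 :=
  apply_eq_zero_of_posSemidef S.posSemidef_k S.k_anchor x

/-- This zero hides the fooling functions from samples that equal the anchor in a relevant
coordinate. -/
theorem mean_anchor : S.mean S.a = 0 := by
  simp [mean, k_anchor_left]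

theorem integrable_k : Integrable (fun z : S.D × S.D => S.k z.1 z.2) (S.ρ.prod S.ρ) := by
  refine Integrable.mono' (((S.integrable_diag.comp_fst S.ρ).add
    (S.integrable_diag.comp_snd S.ρ)).div_const 2) S.measurable_k.aestronglyMeasurable ?_
  exact ae_of_all _ fun z => abs_apply_le_of_posSemidef S.posSemidef_k z.1 z.2

theorem integrable_mean : Integrable S.mean S.ρ := S.integrable_k.integral_prod_left

theorem integral_mean : ∫ x, S.mean x ∂S.ρ = S.C₀ := rfl

theorem C₀_pos' : 0 < S.C₀ := S.C₀_pos

/-- Integrating |k(x,y)| ≤ (k(x,x) + k(y,y))/2 suffices. The bound makes the weights γ_u C₀^|u|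
summable, which is needed to order them. -/
theorem C₀_le : S.C₀ ≤ ∫ x, S.k x x ∂S.ρ := by
  have h1 : S.C₀ = ∫ z : S.D × S.D, S.k z.1 z.2 ∂(S.ρ.prod S.ρ) :=
    (integral_prod _ S.integrable_k).symm
  rw [h1]
  have hi := ((S.integrable_diag.comp_fst S.ρ).add
    (S.integrable_diag.comp_snd S.ρ)).div_const 2
  refine (integral_mono S.integrable_k hi fun z =>
    (le_abs_self _).trans (abs_apply_le_of_posSemidef S.posSemidef_k z.1 z.2)).trans_eq ?_
  rw [integral_div]
  simp only [Pi.add_apply]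
  rw [integral_add (S.integrable_diag.comp_fst S.ρ) (S.integrable_diag.comp_snd S.ρ),
    integral_fun_fst fun x => S.k x x, integral_fun_snd fun x => S.k x x]
  simp

theorem summable_mass : Summable fun u : Finset ℕ+ => S.γ u * S.C₀ ^ u.card :=
  S.summable_γ.of_nonneg_of_le
    (fun u => mul_nonneg (S.γ_nonneg u) (pow_nonneg S.C₀_pos'.le _))
    fun u => mul_le_mul_of_nonneg_left (pow_le_pow_left₀ S.C₀_pos'.le S.C₀_le _) (S.γ_nonneg u)

/-- One coordinate is the mean embedding bound `sq_sum_mean_le`; further coordinates enter through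
`hadamard_sub_rankOne_posSemidef`. -/
theorem smul_kProd_sub_posSemidef (u : Finset ℕ+) :
    (S.C₀ ^ u.card • S.kProd u - rankOne fun x : S.Point => ∏ j ∈ u, S.mean (x j)).PosSemidef := by
  classical
  induction u using Finset.induction_on with
  | empty =>
    have : (S.C₀ ^ (∅ : Finset ℕ+).card • S.kProd ∅ -
        rankOne fun x : S.Point => ∏ j ∈ ∅, S.mean (x j)) = 0 := by
      ext x y; simp [kProd, rankOne]
    rw [this]
    exact Matrix.PosSemidef.zero
  | insert j u hj ih =>
    have h1 : (S.C₀ • S.k - rankOne S.mean).PosSemidef :=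
      (smul_sub_rankOne_posSemidef_iff S.posSemidef_k).mpr fun v =>
        sq_sum_mean_le S.posSemidef_k S.measurable_k S.ρ S.integrable_diag v
    have h2 := hadamard_sub_rankOne_posSemidef
      ((S.kProd_posSemidef u).smul (pow_nonneg S.C₀_pos'.le u.card))
      (h1.submatrix fun x : S.Point => x j) ih
    convert h2 using 1
    ext x y
    simp [kProd, rankOne, Matrix.hadamard, Finset.prod_insert hj, Finset.card_insert_of_notMem hj]
    ring

end Setting

namespace Setting

variable (S : Setting)

/-! ### Functions in the unit ball of `ℋ_γ` -/

theorem hasSum_quadForm_kernel (v : S.domain →₀ ℝ) :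
    HasSum (fun u => S.γ u * quadForm (S.kProd u) (v.mapDomain Subtype.val))
      (quadForm S.kernel v) := by
  have h : ∀ u, S.γ u * quadForm (S.kProd u) (v.mapDomain Subtype.val) =
      ∑ i ∈ v.support, ∑ j ∈ v.support, v i * (S.γ u * S.kProd u i j) * v j := fun u => by
    rw [← quadForm_submatrix]
    simp only [quadForm, Finsupp.sum, Matrix.submatrix_apply, Finset.mul_sum]
    refine Finset.sum_congr rfl fun i _ => Finset.sum_congr rfl fun j _ => by ring
  simp only [h]
  exact hasSum_sum fun i _ => hasSum_sum fun j _ =>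
    ((S.summable_kernel i j).hasSum.mul_left _).mul_right _

theorem sum_quadForm_le (T : Finset (Finset ℕ+)) (v : S.domain →₀ ℝ) :
    ∑ u ∈ T, S.γ u * quadForm (S.kProd u) (v.mapDomain Subtype.val) ≤ quadForm S.kernel v :=
  sum_le_hasSum T (fun u _ => mul_nonneg (S.γ_nonneg u)
    (quadForm_nonneg (S.kProd_posSemidef u) _)) (S.hasSum_quadForm_kernel v)

theorem ball_subset_space : S.ball ⊆ S.space :=
  Set.image_mono (rkhsBall_subset_rkhs _)

/-- The total weight `∑ γ_u C₀^|u|` of a finite family of sets. -/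
noncomputable def mass (T : Finset (Finset ℕ+)) : ℝ := ∑ u ∈ T, S.γ u * S.C₀ ^ u.card

/-- The function `∑ γ_u ∏_{j ∈ u} h(x_j)`, where `h` is the mean embedding of `ρ`. -/
noncomputable def meanSum (T : Finset (Finset ℕ+)) (x : S.Point) : ℝ :=
  ∑ u ∈ T, S.γ u * ∏ j ∈ u, S.mean (x j)

theorem mass_nonneg (T : Finset (Finset ℕ+)) : 0 ≤ S.mass T :=
  Finset.sum_nonneg fun u _ => mul_nonneg (S.γ_nonneg u) (pow_nonneg S.C₀_pos'.le _)

/-- The function `S.meanSum T` has squared norm at most `S.mass T`: Cauchy–Schwarz over T with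
weights γ_u combines the bounds for the single k_u, and the terms of T contribute at most K_γ to the
quadratic form. -/
theorem meanSum_mem_ball (T : Finset (Finset ℕ+)) {c : ℝ} (hc : c ^ 2 * S.mass T ≤ 1) :
    Function.extend (Subtype.val : S.domain → S.Point) (fun x => c * S.meanSum T x) 0 ∈
      S.ball := by
  refine ⟨_, (mem_rkhsBall_iff S.kernel_posSemidef).mpr fun v => ?_, rfl⟩
  let w : S.Point →₀ ℝ := v.mapDomain Subtype.val
  let s : Finset ℕ+ → ℝ := fun u => w.sum fun x c => c * ∏ j ∈ u, S.mean (x j)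
  have h1 : (v.sum fun x b => b * (c * S.meanSum T x)) = c * ∑ u ∈ T, S.γ u * s u := by
    have h2 : ∀ u, s u = ∑ x ∈ v.support, v x * ∏ j ∈ u, S.mean ((x : S.Point) j) := fun u => by
      simp only [s, w]
      rw [Finsupp.sum_mapDomain_index (by simp) (by simp [add_mul])]
      rfl
    simp only [h2, Finsupp.sum, meanSum, Finset.mul_sum]
    rw [Finset.sum_comm]
    refine Finset.sum_congr rfl fun i _ => Finset.sum_congr rfl fun j _ => by ring
  have hs : ∀ u, s u ^ 2 ≤ S.C₀ ^ u.card * quadForm (S.kProd u) w := fun u =>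
    (smul_sub_rankOne_posSemidef_iff (S.kProd_posSemidef u)).mp (S.smul_kProd_sub_posSemidef u) w
  have h3 : (∑ u ∈ T, S.γ u * s u) ^ 2 ≤
      S.mass T * ∑ u ∈ T, S.γ u * quadForm (S.kProd u) w := by
    refine Finset.sum_sq_le_sum_mul_sum_of_sq_le_mul T
      (fun u _ => mul_nonneg (S.γ_nonneg u) (pow_nonneg S.C₀_pos'.le _))
      (fun u _ => mul_nonneg (S.γ_nonneg u) (quadForm_nonneg (S.kProd_posSemidef u) _))
      fun u _ => ?_
    rw [mul_pow, mul_mul_mul_comm, ← sq]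
    exact mul_le_mul_of_nonneg_left (hs u) (sq_nonneg _)
  have h4 := S.sum_quadForm_le T v
  have h5 := quadForm_nonneg S.kernel_posSemidef v
  rw [h1, mul_pow]
  calc c ^ 2 * (∑ u ∈ T, S.γ u * s u) ^ 2
      ≤ c ^ 2 * (S.mass T * quadForm S.kernel v) := by
        refine mul_le_mul_of_nonneg_left (h3.trans ?_) (sq_nonneg c)
        exact mul_le_mul_of_nonneg_left h4 (S.mass_nonneg T)
    _ = c ^ 2 * S.mass T * quadForm S.kernel v := by ring
    _ ≤ 1 * quadForm S.kernel v := mul_le_mul_of_nonneg_right hc h5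
    _ = _ := one_mul _

theorem integral_meanSum (T : Finset (Finset ℕ+)) (c : ℝ) :
    S.integral (Function.extend (Subtype.val : S.domain → S.Point)
      (fun x => c * S.meanSum T x) 0) = c * S.mass T := by
  rw [S.integral_extend fun x => c * S.meanSum T x, integral_const_mul]
  unfold meanSum mass
  have hi := fun u => S.integral_prod_μ S.integrable_mean u
  rw [integral_finsetSum _ fun u _ => (hi u).1.const_mul _]
  congr 1
  refine Finset.sum_congr rfl fun u _ => ?_
  rw [integral_const_mul, (hi u).2, integral_mean]

theorem meanSum_eq_zero {T : Finset (Finset ℕ+)} {v : Finset ℕ+} (hT : ∀ u ∈ T, ¬u ⊆ v)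
    {x : S.Point} (hx : x ∈ S.affine v) : S.meanSum T x = 0 := by
  refine Finset.sum_eq_zero fun u hu => ?_
  -- A coordinate j in u but outside v has x_j = a, which makes the factor h(x_j) vanish.
  obtain ⟨j, hju, hjv⟩ := Finset.not_subset.mp (hT u hu)
  rw [Finset.prod_eq_zero hju, mul_zero]
  rw [hx j hjv, mean_anchor]

theorem extend_meanSum_eq_zero {T : Finset (Finset ℕ+)} {v : Finset ℕ+}
    (hT : ∀ u ∈ T, ¬u ⊆ v) (c : ℝ) {x : S.Point} (hx : x ∈ S.affine v) :
    Function.extend (Subtype.val : S.domain → S.Point) (fun x => c * S.meanSum T x) 0 x = 0 := by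
  by_cases hd : x ∈ S.domain
  · refine (Subtype.val_injective.extend_apply (fun x : S.domain => c * S.meanSum T x) 0
      ⟨x, hd⟩).trans ?_
    simp only [S.meanSum_eq_zero hT hx, mul_zero]
  · rw [Function.extend_apply' _ _ _ (by simpa using hd)]
    rfl

end Setting

/-! ### Lower bounds for the error -/

namespace DetAlgorithm

variable {X : Type} (A : DetAlgorithm X) (f : X → ℝ)

/-- When all answers are zero, adaptivity is useless: the data seen depend only on the number of
evaluations. -/
theorem values_eq_replicate {n : ℕ} (h : ∀ i < n, f (A.samplePoint f i) = 0) :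
    ∀ i ≤ n, A.values f i = List.replicate i 0
  | 0, _ => rfl
  | i + 1, hi => by
    have ih := values_eq_replicate h i (by omega)
    have h0 := h i (by omega)
    rw [samplePoint] at h0
    rw [values, h0, ih, List.replicate_succ']

theorem result_eq_of_values_zero {n : ℕ} (hn : A.numEvals f = n)
    (h : ∀ i < n, f (A.samplePoint f i) = 0) : A.result f = A.output (List.replicate n 0) := by
  rw [result, hn, ENat.toNat_natCast, A.values_eq_replicate f h n le_rfl]

end DetAlgorithm

namespace RandAlgorithm

variable {X : Type} (Q : RandAlgorithm.{u} X)

/-- With a common output r, (t − r)² + (−t − r)² = 2t² + 2r² ≥ 2t² pointwise; integrating shows that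
the two squared errors cannot both be below t². -/
theorem ofReal_sq_le_error_sq {I : (X → ℝ) → ℝ} {F : Set (X → ℝ)} {f g : X → ℝ} {t : ℝ}
    (hf : f ∈ F) (hg : g ∈ F) (hIf : I f = t) (hIg : I g = -t)
    (hm : AEMeasurable (fun w => (Q.alg w).result f) Q.P)
    (h : ∀ᵐ w ∂Q.P, (Q.alg w).result f = (Q.alg w).result g) :
    ENNReal.ofReal (t ^ 2) ≤ Q.error I F ^ 2 := by
  let s := ⨆ f ∈ F, ∫⁻ w, ENNReal.ofReal ((I f - (Q.alg w).result f) ^ 2) ∂Q.P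
  have he : Q.error I F ^ 2 = s := by
    rw [error, ← ENNReal.rpow_natCast, ← ENNReal.rpow_mul]
    norm_num [s]
  rw [he]
  have h1 : ∫⁻ w, ENNReal.ofReal ((t - (Q.alg w).result f) ^ 2) ∂Q.P ≤ s := by
    rw [← hIf]
    exact le_iSup₂_of_le f hf le_rfl
  have h2 : ∫⁻ w, ENNReal.ofReal ((-t - (Q.alg w).result f) ^ 2) ∂Q.P ≤ s := by
    refine le_iSup₂_of_le g hg (le_of_eq (lintegral_congr_ae ?_))
    filter_upwards [h] with w hw
    rw [hw, hIg]
  have h3 : ∫⁻ w, (ENNReal.ofReal (t ^ 2) + ENNReal.ofReal (t ^ 2)) ∂Q.P ≤ s + s := by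
    refine le_trans ?_ (add_le_add h1 h2)
    rw [← lintegral_add_left' ((hm.const_sub t).pow_const 2).ennreal_ofReal]
    refine lintegral_mono fun w => ?_
    rw [← ENNReal.ofReal_add (sq_nonneg _) (sq_nonneg _),
      ← ENNReal.ofReal_add (sq_nonneg _) (sq_nonneg _)]
    refine ENNReal.ofReal_le_ofReal ?_
    nlinarith [sq_nonneg ((Q.alg w).result f)]
  rw [lintegral_const, measure_univ, mul_one, ← two_mul, ← two_mul] at h3
  exact (ENNReal.mul_le_mul_iff_right (by simp) (by simp)).mp h3

end RandAlgorithm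

namespace Setting

variable (S : Setting)

/-- An algorithm in `𝒜^{res-ω}` has an error which is at least the square root of the weight of
all sets that are not contained in one of the index sets that it uses. -/
theorem exists_uncovered_le_error {ω : ℕ} {Q : RandAlgorithm.{u} S.Point}
    (hQ : Q ∈ S.resOmega ω) :
    ∃ (n : ℕ) (v : Fin n → Finset ℕ+), (∀ i, (v i).card ≤ ω) ∧
      ∑ i, S.dollar (v i).card ≤ Q.worstCost S.unrCost S.ball ∧
      ∀ T : Finset (Finset ℕ+), (∀ u ∈ T, ∀ i, ¬u ⊆ v i) →
        ENNReal.ofReal (S.mass T) ≤ Q.error S.integral S.ball ^ 2 := by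
  obtain ⟨hran, n, v, hv, hQ⟩ := hQ
  refine ⟨n, v, hv, ?_, fun T hT => ?_⟩
  -- The expected cost is the same for every f, so the zero function suffices to bound it by the
  -- worst case cost.
  · have h0 := S.meanSum_mem_ball ∅ (c := 0) (by simp)
    rw [← (hQ _ (S.ball_subset_space h0)).2]
    exact le_iSup₂_of_le (f := fun f _ => Q.expectedCost S.unrCost f) _ h0 le_rfl
  · rcases (S.mass_nonneg T).eq_or_lt' with h0 | hpos
    · simp [h0]
    have hsq : √(S.mass T) ^ 2 = S.mass T := Real.sq_sqrt hpos.le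
    have hs0 : √(S.mass T) ≠ 0 := (Real.sqrt_pos.mpr hpos).ne'
    have hball : ∀ c : ℝ, c ^ 2 * S.mass T ≤ 1 → _ := fun c hc => S.meanSum_mem_ball T hc
    -- The scalings c = ±mass(T)^(−1/2) put the function into the unit ball and give it the integral
    -- ±√mass(T).
    have key : (√(S.mass T))⁻¹ * S.mass T = √(S.mass T) := by
      nth_rewrite 2 [← hsq]
      field_simp
    have hc1 : ((√(S.mass T))⁻¹) ^ 2 * S.mass T ≤ 1 := by
      rw [inv_pow, hsq, inv_mul_cancel₀ hpos.ne']
    have hc2 : (-(√(S.mass T))⁻¹) ^ 2 * S.mass T ≤ 1 := by rwa [neg_sq]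
    have hres : ∀ c : ℝ, c ^ 2 * S.mass T ≤ 1 → ∀ᵐ w ∂Q.P, (Q.alg w).result
        (Function.extend (Subtype.val : S.domain → S.Point) (fun x => c * S.meanSum T x) 0) =
        (Q.alg w).output (List.replicate n 0) := fun c hc => by
      filter_upwards [(hQ _ (S.ball_subset_space (hball c hc))).1] with w hw
      exact DetAlgorithm.result_eq_of_values_zero _ _ hw.1 fun i hi =>
        S.extend_meanSum_eq_zero (v := v ⟨i, hi⟩) (fun u hu => hT u hu _) c (hw.2 ⟨i, hi⟩)
    have := Q.ofReal_sq_le_error_sq (hball _ hc1) (hball _ hc2) (I := S.integral)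
      (t := √(S.mass T)) (by rw [integral_meanSum, key])
      (by rw [integral_meanSum, neg_mul, key])
      (hran _ (S.ball_subset_space (hball _ hc1))).2.1.1.aemeasurable
      (by filter_upwards [hres _ hc1, hres _ hc2] with w h1 h2 using h1.trans h2.symm)
    rwa [hsq] at this

end Setting

/-! ### Transfer of algorithms along maps of the sample points -/

namespace DetAlgorithm

variable {X Y : Type}

/-- The algorithm that evaluates at `φ x` whenever `A` evaluates at `x`. -/
def map (A : DetAlgorithm X) (φ : X → Y) : DetAlgorithm Y where
  halt := A.halt
  point l := φ (A.point l)
  output := A.output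

variable (A : DetAlgorithm X) (φ : X → Y) (f : Y → ℝ)

theorem values_map (i : ℕ) : (A.map φ).values f i = A.values (f ∘ φ) i := by
  induction i with
  | zero => rfl
  | succ i ih => rw [values, values, ih]; rfl

theorem numEvals_map : (A.map φ).numEvals f = A.numEvals (f ∘ φ) := by
  unfold numEvals
  simp only [values_map]
  rfl

theorem result_map : (A.map φ).result f = A.result (f ∘ φ) := by
  unfold result
  rw [numEvals_map, values_map]
  rfl

theorem cost_const {f : X → ℝ} {n : ℕ} (hn : A.numEvals f = n) (c : ℝ≥0∞) :
    A.cost f (fun _ => c) = n * c := by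
  unfold cost
  rw [hn, tsum_eq_sum (s := Finset.range n)]
  · rw [Finset.sum_congr rfl fun i hi => if_pos (by exact_mod_cast Finset.mem_range.mp hi)]
    simp
  · intro i hi
    rw [Finset.mem_range] at hi
    rw [if_neg (by exact_mod_cast hi)]

end DetAlgorithm

theorem measurable_of_mem_rkhs {X : Type} [MeasurableSpace X] {K : Matrix X X ℝ}
    (hK : K.PosSemidef) (hm : Measurable fun z : X × X => K z.1 z.2) {f : X → ℝ}
    (hf : f ∈ rkhs K hK) : Measurable f := by
  have : Fact (opKernel K).PosSemidef := ⟨opKernel_posSemidef hK⟩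
  obtain ⟨g, hg⟩ := hf
  rw [show f = fun x => g x from funext hg]
  exact measurable_ofKernel hm g

namespace Setting

variable (S : Setting)

/-- The first coordinate of the points in `𝒳`, and the anchor for all other points. -/
noncomputable def firstCoord (x : S.Point) : S.D :=
  open scoped Classical in if x ∈ S.domain then x 1 else S.a

theorem apply_anchor_of_mem_rkhs {f : S.D → ℝ}
    (hf : f ∈ rkhs S.univKernel S.univKernel_posSemidef) : f S.a = 0 := by
  obtain ⟨r, -, h⟩ := (mem_rkhs_iff _).mp hf
  have := h (Finsupp.single S.a 1)
  simp [quadForm, univKernel, S.k_anchor] at this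
  nlinarith [sq_nonneg (f S.a)]

/-- Since f(a) = 0, sending points outside 𝒳 to the anchor reproduces the extension by zero. -/
theorem comp_firstCoord {f : S.D → ℝ} (hf : f S.a = 0) :
    f ∘ S.firstCoord =
      Function.extend (Subtype.val : S.domain → S.Point) (fun x => f ((x : S.Point) 1)) 0 := by
  ext x
  by_cases hx : x ∈ S.domain
  · refine Eq.trans ?_ (Subtype.val_injective.extend_apply
      (fun x : S.domain => f ((x : S.Point) 1)) 0 ⟨x, hx⟩).symm
    simp [firstCoord, hx]
  · rw [Function.extend_apply' _ _ _ (by simpa using hx)]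
    simp [firstCoord, hx, hf]

/-- The pullback of γ_{1}k along x ↦ x₁ is the single term u = {1} of K_γ, so its quadratic form is
dominated. -/
theorem sq_sum_comp_eval_le {f : S.D → ℝ} {r : ℝ}
    (h : ∀ v : S.D →₀ ℝ, (v.sum fun x c => c * f x) ^ 2 ≤ r ^ 2 * quadForm S.univKernel v)
    (v : S.domain →₀ ℝ) :
    (v.sum fun x c => c * f ((x : S.Point) 1)) ^ 2 ≤ r ^ 2 * quadForm S.kernel v := by
  have h1 := h (v.mapDomain fun x : S.domain => (x : S.Point) 1)
  rw [Finsupp.sum_mapDomain_index (by simp) (by simp [add_mul])] at h1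
  refine h1.trans (mul_le_mul_of_nonneg_left ?_ (sq_nonneg r))
  refine le_trans (le_of_eq ?_) (S.sum_quadForm_le {{1}} v)
  rw [Finset.sum_singleton, univKernel, quadForm_smul, ← quadForm_submatrix,
    ← quadForm_submatrix]
  congr 2
  ext x y
  simp [kProd]

theorem comp_firstCoord_mem_space {f : S.D → ℝ}
    (hf : f ∈ rkhs S.univKernel S.univKernel_posSemidef) : f ∘ S.firstCoord ∈ S.space := by
  rw [S.comp_firstCoord (S.apply_anchor_of_mem_rkhs hf)]
  obtain ⟨r, hr, h⟩ := (mem_rkhs_iff _).mp hf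
  exact ⟨_, (mem_rkhs_iff S.kernel_posSemidef).mpr ⟨r, hr, S.sq_sum_comp_eval_le h⟩, rfl⟩

theorem comp_firstCoord_mem_ball {f : S.D → ℝ}
    (hf : f ∈ rkhsBall S.univKernel S.univKernel_posSemidef) : f ∘ S.firstCoord ∈ S.ball := by
  rw [S.comp_firstCoord (S.apply_anchor_of_mem_rkhs (rkhsBall_subset_rkhs _ hf))]
  refine ⟨_, (mem_rkhsBall_iff S.kernel_posSemidef).mpr fun v => ?_, rfl⟩
  have := S.sq_sum_comp_eval_le (f := f) (r := 1)
    (by simpa using (mem_rkhsBall_iff S.univKernel_posSemidef).mp hf) v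
  simpa using this

theorem integral_comp_firstCoord {f : S.D → ℝ}
    (hf : f ∈ rkhs S.univKernel S.univKernel_posSemidef) :
    S.integral (f ∘ S.firstCoord) = ∫ x, f x ∂S.ρ := by
  have hm : Measurable f := measurable_of_mem_rkhs S.univKernel_posSemidef
    (S.measurable_k.const_mul (S.γ {1})) hf
  rw [S.comp_firstCoord (S.apply_anchor_of_mem_rkhs hf), S.integral_extend fun x => f (x 1),
    ← Measure.infinitePi_map_eval (fun _ : ℕ+ => S.ρ) 1]
  exact (integral_map (measurable_pi_apply (1 : ℕ+)).aemeasurable hm.aestronglyMeasurable).symm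

/-- An algorithm in `𝒜^{res-ω}` yields an algorithm for univariate integration. -/
theorem univMinError_le {ω : ℕ} {Q : RandAlgorithm.{u} S.Point} (hQ : Q ∈ S.resOmega ω)
    {N : ℝ≥0} (hN : S.dollar 1 * Q.worstCost S.unrCost S.ball ≤ N) :
    univMinError.{u} S N ≤ Q.error S.integral S.ball := by
  obtain ⟨hran, n, v, -, hQ⟩ := hQ
  -- Every evaluation costs at least 1.
  have hn : (n : ℝ≥0∞) ≤ Q.worstCost S.unrCost S.ball := by
    have h0 := S.meanSum_mem_ball ∅ (c := 0) (by simp)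
    refine le_iSup₂_of_le (f := fun f _ => Q.expectedCost S.unrCost f) _ h0 ?_
    rw [(hQ _ (S.ball_subset_space h0)).2]
    refine le_trans (le_of_eq ?_) (Finset.sum_le_sum fun i _ => S.one_le_dollar (v i).card)
    simp
  -- The same n evaluations are made at first coordinates, now at price $(1) each; this explains the
  -- factor `S.dollar 1` in `hN`.
  let Q' : RandAlgorithm.{u} S.D :=
    { Ω := Q.Ω, P := Q.P, alg := fun w => (Q.alg w).map S.firstCoord }
  have hnum : ∀ f ∈ rkhs S.univKernel S.univKernel_posSemidef,
      ∀ᵐ w ∂Q.P, ((Q.alg w).map S.firstCoord).numEvals f = n := fun f hf => by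
    filter_upwards [(hQ _ (S.comp_firstCoord_mem_space hf)).1] with w hw
    rw [DetAlgorithm.numEvals_map]
    exact hw.1
  have hcost : ∀ f ∈ rkhs S.univKernel S.univKernel_posSemidef,
      (fun w => ((Q.alg w).map S.firstCoord).cost f fun _ => S.dollar 1) =ᵐ[Q.P]
        fun _ => n * S.dollar 1 := fun f hf => by
    filter_upwards [hnum f hf] with w hw
    exact DetAlgorithm.cost_const _ hw _
  have hQ'ran : Q' ∈ RandAlgorithm.ran (fun _ => S.dollar 1)
      (rkhs S.univKernel S.univKernel_posSemidef) := by
    refine fun f hf => ⟨?_, ?_, ?_⟩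
    · filter_upwards [hnum f hf] with w hw
      exact hw.trans_lt (ENat.natCast_lt_top n)
    · simp only [Q', DetAlgorithm.result_map]
      exact (hran _ (S.comp_firstCoord_mem_space hf)).2.1
    · exact aemeasurable_const.congr (hcost f hf).symm
  have hQ'cost : Q'.worstCost (fun _ => S.dollar 1)
      (rkhsBall S.univKernel S.univKernel_posSemidef) ≤ N := by
    refine iSup₂_le fun f hf => ?_
    refine (lintegral_congr_ae (hcost f (rkhsBall_subset_rkhs _ hf))).trans_le ?_
    rw [lintegral_const, measure_univ, mul_one, mul_comm]
    exact (mul_le_mul_right hn _).trans hN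
  have hQ'err : Q'.error (fun f => ∫ x, f x ∂S.ρ)
      (rkhsBall S.univKernel S.univKernel_posSemidef) ≤ Q.error S.integral S.ball := by
    refine ENNReal.rpow_le_rpow (iSup₂_le fun f hf => ?_) (by norm_num)
    refine le_iSup₂_of_le (f := fun f _ => ∫⁻ w, ENNReal.ofReal
      ((S.integral f - (Q.alg w).result f) ^ 2) ∂Q.P) _ (S.comp_firstCoord_mem_ball hf) ?_
    simp only [Q', DetAlgorithm.result_map,
      S.integral_comp_firstCoord (rkhsBall_subset_rkhs _ hf)]
    exact le_rfl
  exact (iInf₂_le Q' ⟨hQ'ran, hQ'cost⟩).trans hQ'err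

end Setting

/-! ### Orderings of summable families -/

/-- Greedy choice of a largest remaining weight. It exists because summability leaves only finitely
many weights above a positive level. An element never chosen would bound a null sequence below by
its positive weight. -/
theorem exists_antitone_enumeration {ι : Type*} {A : Set ι} (hA : A.Infinite) {b : ι → ℝ}
    (hb : Summable b) (hpos : ∀ i ∈ A, 0 < b i) :
    ∃ u : ℕ → ι, Function.Injective u ∧ Set.range u = A ∧ Antitone fun n => b (u n) := by
  classical
  have hmax : ∀ F : Finset ι, ∃ x, (x ∈ A ∧ x ∉ F) ∧ ∀ y, y ∈ A → y ∉ F → b y ≤ b x := by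
    intro F
    obtain ⟨x₀, hx₀, hx₀F⟩ := hA.exists_notMem_finset F
    have hfin : {y | b x₀ ≤ b y}.Finite := by
      have := hb.tendsto_cofinite_zero.eventually_lt_const (hpos x₀ hx₀)
      simpa [Filter.eventually_cofinite] using this
    obtain ⟨x, ⟨⟨hxA, hxF⟩, hx0⟩, hx⟩ := Set.exists_max_image
      ({y | y ∈ A ∧ y ∉ F} ∩ {y | b x₀ ≤ b y}) b (hfin.inter_of_right _)
      ⟨x₀, ⟨hx₀, hx₀F⟩, le_refl (b x₀)⟩
    refine ⟨x, ⟨hxA, hxF⟩, fun y hyA hyF => ?_⟩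
    by_cases hy : b x₀ ≤ b y
    · exact hx y ⟨⟨hyA, hyF⟩, hy⟩
    · exact (not_le.mp hy).le.trans hx0
  choose pick hpick hpick_max using hmax
  let F : ℕ → Finset ι := fun n => Nat.rec ∅ (fun _ G => insert (pick G) G) n
  have hF : ∀ n, F (n + 1) = insert (pick (F n)) (F n) := fun n => rfl
  have hFmono : Monotone F := monotone_nat_of_le_succ fun n => by
    rw [hF]; exact Finset.subset_insert _ _
  have hmem : ∀ m n, m < n → pick (F m) ∈ F n := fun m n h =>
    hFmono (Nat.succ_le_of_lt h) (by rw [hF]; exact Finset.mem_insert_self _ _)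
  have hinj : Function.Injective fun n => pick (F n) := by
    have hne : ∀ m n, m < n → pick (F m) ≠ pick (F n) := fun m n hmn h =>
      (hpick (F n)).2 (h ▸ hmem m n hmn)
    intro m n h
    by_contra hmn
    rcases lt_or_gt_of_ne hmn with h1 | h1
    exacts [hne m n h1 h, hne n m h1 h.symm]
  have hFrange : ∀ n, ∀ x ∈ F n, x ∈ Set.range fun n => pick (F n) := by
    intro n
    induction n with
    | zero => simp [F]
    | succ n ih =>
      intro x hx
      rw [hF, Finset.mem_insert] at hx
      rcases hx with rfl | hx
      · exact ⟨n, rfl⟩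
      · exact ih x hx
  refine ⟨fun n => pick (F n), hinj, Set.Subset.antisymm ?_ fun w hw => ?_,
    antitone_nat_of_succ_le fun n => ?_⟩
  · rintro _ ⟨n, rfl⟩
    exact (hpick (F n)).1
  · by_contra hne
    have h1 : ∀ n, b w ≤ b (pick (F n)) := fun n =>
      hpick_max (F n) w hw fun h => hne (hFrange n w h)
    have h2 := (hb.comp_injective hinj).tendsto_atTop_zero
    exact absurd (ge_of_tendsto' h2 h1) (not_le.mpr (hpos w hw))
  · exact hpick_max (F n) _ (hpick (F (n + 1))).1
      fun h => (hpick (F (n + 1))).2 (hFmono n.le_succ h)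

/-- If every finite family that avoids a suitable set of at most `m` indices has total weight at
most `t`, then the `2m`-th largest weight is at most `t / (m + 1)`. -/
theorem mul_antitone_enumeration_le {ι : Type*} {b : ι → ℝ} {u : ℕ → ι}
    (hu : Function.Injective u) (hanti : Antitone fun n => b (u n)) (h0 : ∀ n, 0 ≤ b (u n))
    {W : Finset ι} {m : ℕ} (hW : W.card ≤ m) {t : ℝ}
    (h : ∀ J : Finset ℕ, (∀ j ∈ J, u j ∉ W) → ∑ j ∈ J, b (u j) ≤ t) :
    (m + 1) * b (u (2 * m)) ≤ t := by
  classical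
  -- Of the first 2m + 1 indices at most m are lost to W; each remaining one has weight at least
  -- that of index 2m.
  let J := (Finset.range (2 * m + 1)).filter fun j => u j ∉ W
  have hc : m + 1 ≤ J.card := by
    have h1 := Finset.card_filter_add_card_filter_not (s := Finset.range (2 * m + 1))
      fun j => u j ∉ W
    have h2 : ((Finset.range (2 * m + 1)).filter fun j => ¬u j ∉ W).card ≤ W.card :=
      Finset.card_le_card_of_injOn u (fun j hj => by
        have := (Finset.mem_filter.mp hj).2
        exact not_not.mp this) hu.injOn
    rw [Finset.card_range] at h1
    change m + 1 ≤ ((Finset.range (2 * m + 1)).filter fun j => u j ∉ W).card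
    omega
  calc ((m : ℝ) + 1) * b (u (2 * m)) ≤ J.card * b (u (2 * m)) :=
        mul_le_mul_of_nonneg_right (by exact_mod_cast hc) (h0 _)
    _ = ∑ _j ∈ J, b (u (2 * m)) := by simp
    _ ≤ ∑ j ∈ J, b (u j) := Finset.sum_le_sum fun j hj => hanti (by
        have := Finset.mem_range.mp (Finset.mem_filter.mp hj).1
        omega)
    _ ≤ t := h J fun j hj => (Finset.mem_filter.mp hj).2

/-! ### Consequences of a polynomial bound for the complexity -/

namespace Setting

variable (S : Setting)

/-- Polynomial bounds for the complexity yield algorithms with cost and error guarantees. -/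
theorem exists_algorithm {ω : ℕ} {p C : ℝ} (hC : 0 < C)
    (H : ∀ ε : ℝ, 0 < ε → RandAlgorithm.complexity (S.resOmega.{u} ω) S.unrCost S.integral S.ball ε
      ≤ ENNReal.ofReal (C * ε ^ (-p))) {ε : ℝ} (hε : 0 < ε) :
    ∃ Q ∈ S.resOmega.{u} ω, Q.error S.integral S.ball ≤ ENNReal.ofReal ε ∧
      Q.worstCost S.unrCost S.ball ≤ ENNReal.ofReal (2 * C * ε ^ (-p)) := by
  have hp : 0 < C * ε ^ (-p) := mul_pos hC (Real.rpow_pos_of_pos hε _)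
  -- The factor 2 makes the inequality strict, so some algorithm realises it although the infimum
  -- need not be attained.
  have hlt : RandAlgorithm.complexity (S.resOmega.{u} ω) S.unrCost S.integral S.ball ε <
      ENNReal.ofReal (2 * C * ε ^ (-p)) :=
    (H ε hε).trans_lt ((ENNReal.ofReal_lt_ofReal_iff (by linarith)).mpr (by linarith))
  obtain ⟨Q, hQ⟩ := iInf_lt_iff.mp hlt
  obtain ⟨⟨hQ1, hQ2⟩, hQ3⟩ := iInf_lt_iff.mp hQ
  exact ⟨Q, hQ1, hQ2, hQ3.le⟩

theorem mass_le_sq_of_error_le {Q : RandAlgorithm.{u} S.Point} {T : Finset (Finset ℕ+)} {ε : ℝ}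
    (hε : 0 < ε) (h : ENNReal.ofReal (S.mass T) ≤ Q.error S.integral S.ball ^ 2)
    (he : Q.error S.integral S.ball ≤ ENNReal.ofReal ε) : S.mass T ≤ ε ^ 2 := by
  have h1 := h.trans (pow_le_pow_left' he 2)
  rw [← ENNReal.ofReal_pow hε.le] at h1
  exact (ENNReal.ofReal_le_ofReal_iff (sq_nonneg ε)).mp h1

/-- If $(1) = ∞, finite cost forces all vᵢ to be empty. Then {1} is uncovered and the error cannot
fall below √(γ_{1}C₀). -/
theorem dollar_one_ne_top {ω : ℕ} (hγ : 0 < S.γ {1}) {p C : ℝ} (hC : 0 < C)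
    (H : ∀ ε : ℝ, 0 < ε → RandAlgorithm.complexity (S.resOmega.{u} ω) S.unrCost S.integral S.ball ε
      ≤ ENNReal.ofReal (C * ε ^ (-p))) : S.dollar 1 ≠ ⊤ := by
  intro htop
  have hm : 0 < S.mass {{1}} := by
    simpa [mass] using mul_pos hγ S.C₀_pos'
  have hε : 0 < √(S.mass {{1}}) / 2 := by positivity
  obtain ⟨Q, hQ, he, hc⟩ := S.exists_algorithm hC H hε
  obtain ⟨n, v, -, hcost, hlow⟩ := S.exists_uncovered_le_error hQ
  have hv : ∀ i, v i = ∅ := fun i => by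
    by_contra hne
    have h1 : 1 ≤ (v i).card := Finset.one_le_card.mpr (Finset.nonempty_iff_ne_empty.mpr hne)
    have h2 : (⊤ : ℝ≥0∞) ≤ ∑ i, S.dollar (v i).card :=
      (htop.symm.le.trans (S.dollar_mono h1)).trans
        (Finset.single_le_sum (f := fun i => S.dollar (v i).card) (fun _ _ => zero_le)
          (Finset.mem_univ i))
    exact absurd ((h2.trans hcost).trans hc) (by simp)
  have := S.mass_le_sq_of_error_le hε (hlow {{1}} (by simp [hv])) he
  rw [div_pow, Real.sq_sqrt hm.le] at this
  linarith

/-- Univariate error at most ε is reached with budget N of order ε⁻ᵖ. The lower bound then gives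
ε^{pα/2} = O(ε) as ε → 0, hence pα/2 ≥ 1. -/
theorem two_div_le_of_univMinError {ω : ℕ} (hγ : 0 < S.γ {1}) {α : ℝ} (hα : 0 < α)
    (huniv : ∃ c : ℝ, 0 < c ∧ ∀ᶠ N : ℝ≥0 in atTop,
      ENNReal.ofReal (c * (N : ℝ) ^ (-(α / 2))) ≤ univMinError.{u} S N)
    {p C : ℝ} (hp : 0 ≤ p) (hC : 0 < C)
    (H : ∀ ε : ℝ, 0 < ε → RandAlgorithm.complexity (S.resOmega.{u} ω) S.unrCost S.integral S.ball ε
      ≤ ENNReal.ofReal (C * ε ^ (-p))) : 2 / α ≤ p := by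
  have htop := S.dollar_one_ne_top hγ hC H
  obtain ⟨c, hc, hev⟩ := huniv
  obtain ⟨N₀, hN₀⟩ := eventually_atTop.mp hev
  let d : ℝ := (S.dollar 1).toReal
  have hd : ENNReal.ofReal d = S.dollar 1 := ENNReal.ofReal_toReal htop
  have hd0 : 0 ≤ d := ENNReal.toReal_nonneg
  -- The summands pay for the evaluations, keep the budget Bε⁻ᵖ above N₀ when ε ≤ 1, and make B
  -- positive.
  let B : ℝ := d * (2 * C) + N₀ + 1
  have hB : 0 < B := by positivity
  have key : ∀ ε : ℝ, 0 < ε → ε ≤ 1 → c * (B * ε ^ (-p)) ^ (-(α / 2)) ≤ ε := by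
    intro ε hε hε1
    obtain ⟨Q, hQ, he, hcost⟩ := S.exists_algorithm hC H hε
    have hεp : 1 ≤ ε ^ (-p) := Real.one_le_rpow_of_pos_of_le_one_of_nonpos hε hε1 (by linarith)
    let N : ℝ≥0 := ⟨B * ε ^ (-p), by positivity⟩
    have hNN₀ : N₀ ≤ N := by
      rw [← NNReal.coe_le_coe]
      change (N₀ : ℝ) ≤ B * ε ^ (-p)
      have h1 : (N₀ : ℝ) ≤ B := by
        have : 0 ≤ d * (2 * C) := by positivity
        simp only [B]; linarith
      nlinarith
    have hle : S.dollar 1 * Q.worstCost S.unrCost S.ball ≤ N := by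
      refine (mul_le_mul_right hcost _).trans ?_
      rw [← hd, ← ENNReal.ofReal_mul hd0, ← ENNReal.ofReal_coe_nnreal]
      refine ENNReal.ofReal_le_ofReal ?_
      change d * (2 * C * ε ^ (-p)) ≤ B * ε ^ (-p)
      rw [← mul_assoc]
      refine mul_le_mul_of_nonneg_right ?_ (by linarith)
      have : (0 : ℝ) ≤ N₀ := N₀.2
      simp only [B]; linarith
    have h2 := (hN₀ N hNN₀).trans ((S.univMinError_le hQ hle).trans he)
    exact (ENNReal.ofReal_le_ofReal_iff hε.le).mp h2
  by_contra! hlt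
  have hx : 0 < 1 - p * (α / 2) := by
    have := (lt_div_iff₀ hα).mp hlt
    linarith
  have hc' : 0 < c * B ^ (-(α / 2)) := mul_pos hc (Real.rpow_pos_of_pos hB _)
  have hlim : Tendsto (fun ε : ℝ => ε ^ (1 - p * (α / 2))) (𝓝[>] 0) (𝓝 0) := by
    have := (Real.continuous_rpow_const (q := 1 - p * (α / 2)) hx.le).tendsto 0
    rw [Real.zero_rpow hx.ne'] at this
    exact this.mono_left nhdsWithin_le_nhds
  have h1 : ∀ᶠ ε : ℝ in 𝓝[>] 0, ε ≤ 1 :=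
    nhdsWithin_le_nhds (Iic_mem_nhds one_pos)
  have h2 : ∀ᶠ ε : ℝ in 𝓝[>] 0, 0 < ε := self_mem_nhdsWithin
  obtain ⟨ε, hε, hε1, hεlt⟩ := (h2.and (h1.and (hlim.eventually_lt_const hc'))).exists
  have h3 := key ε hε hε1
  rw [Real.mul_rpow hB.le (Real.rpow_nonneg hε.le _), ← Real.rpow_mul hε.le] at h3
  have h4 : ε ^ (1 - p * (α / 2)) * ε ^ (-p * (-(α / 2))) = ε := by
    rw [← Real.rpow_add hε]
    ring_nf
    exact Real.rpow_one ε
  have h5 : 0 < ε ^ (-p * (-(α / 2))) := Real.rpow_pos_of_pos hε _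
  have h6 := mul_lt_mul_of_pos_right hεlt h5
  rw [h4, mul_assoc] at h6
  linarith

/-- Polynomial bounds for the complexity bound the tails of the weights. -/
theorem exists_finset_mass_le {ω : ℕ} {p C : ℝ} (hC : 0 < C)
    (H : ∀ ε : ℝ, 0 < ε → RandAlgorithm.complexity (S.resOmega.{u} ω) S.unrCost S.integral S.ball ε
      ≤ ENNReal.ofReal (C * ε ^ (-p))) {ε : ℝ} (hε : 0 < ε) :
    ∃ W : Finset (Finset ℕ+), (W.card : ℝ) ≤ 2 ^ ω * (2 * C) * ε ^ (-p) ∧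
      ∀ T : Finset (Finset ℕ+), (∀ u ∈ T, u ∉ W) → S.mass T ≤ ε ^ 2 := by
  obtain ⟨Q, hQ, he, hc⟩ := S.exists_algorithm hC H hε
  obtain ⟨n, v, hv, hcost, hlow⟩ := S.exists_uncovered_le_error hQ
  -- W consists of all covered sets, namely the subsets of the vᵢ. The bound |vᵢ| ≤ ω enters here:
  -- each vᵢ covers at most 2^ω sets.
  refine ⟨Finset.univ.biUnion fun i => (v i).powerset, ?_, fun T hT => ?_⟩
  · have h1 : (Finset.univ.biUnion fun i => (v i).powerset).card ≤ n * 2 ^ ω := by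
      refine (Finset.card_biUnion_le_card_mul _ _ (2 ^ ω) fun i _ => ?_).trans_eq (by simp)
      rw [Finset.card_powerset]
      exact Nat.pow_le_pow_right (by norm_num) (hv i)
    have h2 : (n : ℝ≥0∞) ≤ ENNReal.ofReal (2 * C * ε ^ (-p)) := by
      refine le_trans ?_ (hcost.trans hc)
      refine le_trans (le_of_eq ?_) (Finset.sum_le_sum fun i _ => S.one_le_dollar (v i).card)
      simp
    rw [← ENNReal.ofReal_natCast, ENNReal.ofReal_le_ofReal_iff (by positivity)] at h2
    calc _ ≤ ((n * 2 ^ ω : ℕ) : ℝ) := by exact_mod_cast h1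
      _ = 2 ^ ω * n := by push_cast; ring
      _ ≤ 2 ^ ω * (2 * C * ε ^ (-p)) := by gcongr
      _ = _ := by ring
  · refine S.mass_le_sq_of_error_le hε (hlow T fun u hu i hi => hT u hu ?_) he
    exact Finset.mem_biUnion.mpr ⟨i, Finset.mem_univ i, Finset.mem_powerset.mpr hi⟩

theorem cutOff_eq_of_mem_activeSets {γ : Finset ℕ+ → ℝ} {σ : ℕ} {u : Finset ℕ+}
    (h : u ∈ activeSets (cutOff γ σ)) : cutOff γ σ u = γ u := by
  have := h.2
  unfold cutOff at this ⊢
  split_ifs at this ⊢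
  · rfl
  · exact absurd this (lt_irrefl _)

/-- With infinitely many active sets, `decay` needs an ordering to exist; summability of γ_u C₀^|u|
provides one. -/
theorem exists_isOrdering {σ : ℕ} (hinf : (activeSets (cutOff S.γ σ)).Infinite) :
    ∃ u, IsOrdering (cutOff S.γ σ) S.C₀ u := by
  refine exists_antitone_enumeration hinf (b := fun u => cutOff S.γ σ u * S.C₀ ^ u.card) ?_
    fun u hu => mul_pos hu.2 (pow_pos S.C₀_pos' _)
  have h0 : ∀ u : Finset ℕ+, 0 ≤ S.C₀ ^ u.card := fun u => pow_nonneg S.C₀_pos'.le _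
  refine S.summable_mass.of_nonneg_of_le (fun u => mul_nonneg ?_ (h0 u))
    fun u => mul_le_mul_of_nonneg_right ?_ (h0 u)
  · unfold cutOff
    split_ifs
    exacts [S.γ_nonneg u, le_rfl]
  · unfold cutOff
    split_ifs
    exacts [le_rfl, S.γ_nonneg u]

/-- Here m bounds the number of covered sets. The cut-off is harmless because the test families may
be restricted to active sets, on which it leaves γ unchanged. -/
theorem mul_ordering_le {ω σ : ℕ} {p C : ℝ} (hC : 0 < C)
    (H : ∀ ε : ℝ, 0 < ε → RandAlgorithm.complexity (S.resOmega.{u} ω) S.unrCost S.integral S.ball ε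
      ≤ ENNReal.ofReal (C * ε ^ (-p))) {u : ℕ → Finset ℕ+}
    (hu : IsOrdering (cutOff S.γ σ) S.C₀ u) {ε : ℝ} (hε : 0 < ε) {m : ℕ}
    (hm : 2 ^ ω * (2 * C) * ε ^ (-p) ≤ m) :
    (m + 1) * (cutOff S.γ σ (u (2 * m)) * S.C₀ ^ (u (2 * m)).card) ≤ ε ^ 2 := by
  obtain ⟨W, hW, hT⟩ := S.exists_finset_mass_le hC H hε
  have hact : ∀ j, u j ∈ activeSets (cutOff S.γ σ) := fun j => hu.2.1 ▸ Set.mem_range_self j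
  refine mul_antitone_enumeration_le (b := fun u => cutOff S.γ σ u * S.C₀ ^ u.card) hu.1 hu.2.2
    (fun j => (mul_pos (hact j).2 (pow_pos S.C₀_pos' _)).le) (W := W)
    (by exact_mod_cast hW.trans hm) fun J hJ => ?_
  refine le_trans (le_of_eq ?_) (hT (J.map ⟨u, hu.1⟩) (by simpa using hJ))
  rw [mass, Finset.sum_map]
  refine Finset.sum_congr rfl fun j _ => ?_
  rw [cutOff_eq_of_mem_activeSets (hact j)]
  rfl

/-- Choosing ε so that m sets are covered gives b(2m) ≤ ε²/(m+1) with ε² of order m^(−2/p), hence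
b(j) = O(j^{−(2/p+1)}). -/
theorem tendsto_ordering_mul_rpow {ω σ : ℕ} {p C : ℝ} (hp : 0 < p) (hC : 0 < C)
    (H : ∀ ε : ℝ, 0 < ε → RandAlgorithm.complexity (S.resOmega.{u} ω) S.unrCost S.integral S.ball ε
      ≤ ENNReal.ofReal (C * ε ^ (-p))) {u : ℕ → Finset ℕ+}
    (hu : IsOrdering (cutOff S.γ σ) S.C₀ u) {q : ℝ} (hq : q < 2 / p + 1) :
    Tendsto (fun j : ℕ => cutOff S.γ σ (u j) * S.C₀ ^ (u j).card * ((j : ℝ) + 1) ^ q)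
      atTop (𝓝 0) := by
  let b : ℕ → ℝ := fun j => cutOff S.γ σ (u j) * S.C₀ ^ (u j).card
  have hact : ∀ j, u j ∈ activeSets (cutOff S.γ σ) := fun j => hu.2.1 ▸ Set.mem_range_self j
  have hb0 : ∀ j, 0 ≤ b j := fun j => (mul_pos (hact j).2 (pow_pos S.C₀_pos' _)).le
  let B : ℝ := 2 ^ ω * (2 * C)
  have hB : 0 < B := by positivity
  let K : ℝ := (4 * B) ^ (2 / p) * 4
  have hbound : ∀ j : ℕ, 2 ≤ j → b j ≤ K * ((j : ℝ) + 1) ^ (-(2 / p + 1)) := by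
    intro j hj
    -- Rounding down gives 2m ≤ j, while j ≥ 2 ensures j + 1 ≤ 4m, so m and j are comparable.
    obtain ⟨m, hm⟩ : ∃ m, m = j / 2 := ⟨_, rfl⟩
    have hm1 : 1 ≤ m := by omega
    have hjm : 2 * m ≤ j := by omega
    have hjm' : j + 1 ≤ 4 * m := by omega
    have hm0 : (0 : ℝ) < m := by exact_mod_cast hm1
    -- The solution of B ε⁻ᵖ = m.
    let ε : ℝ := (B / m) ^ (1 / p)
    have hε : 0 < ε := by positivity
    have h1 : B * ε ^ (-p) = m := by
      simp only [ε]
      rw [← Real.rpow_mul (by positivity), show 1 / p * -p = -1 by field_simp, Real.rpow_neg_one]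
      field_simp
    have h2 : ((m : ℝ) + 1) * b (2 * m) ≤ ε ^ 2 := S.mul_ordering_le hC H hu hε h1.le
    have h3 : ε ^ 2 = (B / m) ^ (2 / p) := by
      simp only [ε]
      rw [← Real.rpow_natCast, ← Real.rpow_mul (by positivity)]
      congr 1
      push_cast
      ring
    have hj0 : (0 : ℝ) < (j : ℝ) + 1 := by positivity
    have hmj : (j : ℝ) + 1 ≤ 4 * m := by exact_mod_cast hjm'
    have h4 : B / m ≤ 4 * B / (j + 1) := by
      rw [div_le_div_iff₀ hm0 hj0]
      nlinarith
    have h5 : (B / m) ^ (2 / p) ≤ (4 * B / (j + 1)) ^ (2 / p) :=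
      Real.rpow_le_rpow (by positivity) h4 (by positivity)
    have h6 : b j ≤ b (2 * m) := hu.2.2 hjm
    have h7 : (((j : ℝ) + 1) / 4) * b j ≤ (4 * B / (j + 1)) ^ (2 / p) := by
      refine le_trans ?_ (h2.trans (h3.le.trans h5))
      exact mul_le_mul (by linarith) h6 (hb0 j) (by positivity)
    rw [Real.div_rpow (by positivity) hj0.le] at h7
    rw [neg_add, Real.rpow_add hj0, Real.rpow_neg hj0.le, Real.rpow_neg_one]
    calc b j = (4 / ((j : ℝ) + 1)) * ((((j : ℝ) + 1) / 4) * b j) := by field_simp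
      _ ≤ (4 / ((j : ℝ) + 1)) * ((4 * B) ^ (2 / p) / ((j : ℝ) + 1) ^ (2 / p)) := by gcongr
      _ = _ := by simp only [K]; ring
  have hlim : Tendsto (fun j : ℕ => K * ((j : ℝ) + 1) ^ (-(2 / p + 1 - q))) atTop (𝓝 0) := by
    have h1 := (tendsto_rpow_neg_atTop (y := 2 / p + 1 - q) (by linarith)).comp
      (tendsto_atTop_add_const_right atTop (1 : ℝ) tendsto_natCast_atTop_atTop)
    simpa using h1.const_mul K
  refine tendsto_of_tendsto_of_tendsto_of_le_of_le' tendsto_const_nhds hlim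
    (Eventually.of_forall fun j => mul_nonneg (hb0 j) (by positivity)) ?_
  filter_upwards [eventually_ge_atTop 2] with j hj
  have hj0 : (0 : ℝ) < (j : ℝ) + 1 := by positivity
  calc b j * ((j : ℝ) + 1) ^ q
      ≤ K * ((j : ℝ) + 1) ^ (-(2 / p + 1)) * ((j : ℝ) + 1) ^ q :=
        mul_le_mul_of_nonneg_right (hbound j hj) (by positivity)
    _ = _ := by rw [mul_assoc, ← Real.rpow_add hj0]; ring_nf

theorem decay_eq_top_of_finite {γ : Finset ℕ+ → ℝ} {C₀ : ℝ} (h : (activeSets γ).Finite) :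
    decay γ C₀ = ⊤ := by
  refine EReal.eq_top_iff_forall_lt _ |>.mpr fun y => ?_
  refine lt_of_lt_of_le (EReal.coe_lt_coe_iff.mpr (lt_add_one y)) ?_
  exact le_iSup₂_of_le (f := fun (p : ℝ) _ => (p : EReal)) (y + 1) (Or.inl h) le_rfl

theorem two_div_decay_le {ω σ : ℕ} {p : ℝ≥0} {C : ℝ} (hC : 0 < C)
    (H : ∀ ε : ℝ, 0 < ε → RandAlgorithm.complexity (S.resOmega.{u} ω) S.unrCost S.integral S.ball ε
      ≤ ENNReal.ofReal (C * ε ^ (-(p : ℝ)))) :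
    2 / (decay (cutOff S.γ σ) S.C₀ - 1).toENNReal ≤ (p : ℝ≥0∞) := by
  by_cases hfin : (activeSets (cutOff S.γ σ)).Finite
  · rw [decay_eq_top_of_finite hfin]
    have : (⊤ : EReal) - 1 = ⊤ := EReal.top_sub_coe 1
    simp [this]
  obtain ⟨u, hu⟩ := S.exists_isOrdering hfin
  rcases eq_or_ne p 0 with rfl | hp
  -- For p = 0 the number of covered sets is bounded independently of ε, so a fixed positive weight
  -- t would satisfy (m+1)t ≤ ε² for every ε > 0; ε² = t/2 refutes this.
  · exfalso
    obtain ⟨m, hm⟩ := exists_nat_ge ((2 : ℝ) ^ ω * (2 * C))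
    set t := cutOff S.γ σ (u (2 * m)) * S.C₀ ^ (u (2 * m)).card with ht
    have hact : u (2 * m) ∈ activeSets (cutOff S.γ σ) := hu.2.1 ▸ Set.mem_range_self _
    have htpos : 0 < t := mul_pos hact.2 (pow_pos S.C₀_pos' _)
    have := S.mul_ordering_le hC H hu (ε := √(t / 2)) (by positivity) (m := m) (by simpa using hm)
    rw [Real.sq_sqrt (by positivity), ← ht] at this
    nlinarith [(Nat.cast_nonneg m : (0 : ℝ) ≤ m)]
  · have hp0 : (0 : ℝ) < p := by exact_mod_cast pos_iff_ne_zero.mpr hp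
    have h1 : ((2 / (p : ℝ) + 1 : ℝ) : EReal) ≤ decay (cutOff S.γ σ) S.C₀ := by
      -- Only exponents q strictly below 2/p + 1 are known to be admissible; their supremum is
      -- enough.
      refine EReal.ge_of_forall_gt_iff_ge.mp fun q hq => ?_
      exact le_iSup₂_of_le (f := fun (q : ℝ) _ => (q : EReal)) q (Or.inr ⟨u, hu,
        S.tendsto_ordering_mul_rpow hp0 hC H hu (EReal.coe_lt_coe_iff.mp hq)⟩) le_rfl
    have h2 := EReal.toENNReal_le_toENNReal (EReal.sub_le_sub h1 (le_refl (1 : EReal)))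
    have h3 : ((2 / (p : ℝ) + 1 : ℝ) : EReal) - 1 = ((2 / (p : ℝ) : ℝ) : EReal) := by
      rw [← EReal.coe_one, ← EReal.coe_sub, add_sub_cancel_right]
    rw [h3, EReal.toENNReal_of_ne_top (EReal.coe_ne_top _), EReal.toReal_coe] at h2
    refine (ENNReal.div_le_div_left h2 2).trans (le_of_eq ?_)
    rw [← ENNReal.ofReal_ofNat 2, ← ENNReal.ofReal_div_of_pos (by positivity),
      div_div_cancel₀ two_ne_zero, ENNReal.ofReal_coe_nnreal]

end Setting

end InfInt

theorem theorem3p2 (S : InfInt.Setting)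
    (s : ℝ) (hs : 0 < s)
    (hdollar : ∃ c : ℝ, 0 < c ∧ ∀ᶠ ν : ℕ in atTop, ENNReal.ofReal (c * (ν : ℝ) ^ s) ≤ S.dollar ν)
    (hγ : 0 < S.γ {1})
    (α : ℝ) (hα : 0 < α)
    (huniv : ∃ c : ℝ, 0 < c ∧ ∀ᶠ N : ℝ≥0 in atTop,
      ENNReal.ofReal (c * (N : ℝ) ^ (-(α / 2))) ≤ InfInt.Setting.univMinError.{u} S N)
    (ω : ℕ) (hω : 1 ≤ ω) :
    max (ENNReal.ofReal (2 / α))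
        (⨆ σ : ℕ+, 2 / (InfInt.decay (InfInt.cutOff S.γ σ) S.C₀ - 1).toENNReal)
      ≤ InfInt.Setting.pResOmega.{u} S ω := by
  refine le_iInf₂ fun p ⟨C, hC, H⟩ => max_le ?_ (iSup_le fun σ => S.two_div_decay_le hC H)
  exact ENNReal.ofReal_le_of_le_toReal
    (S.two_div_le_of_univMinError hγ hα huniv p.2 hC H)
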